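/- Definitions. A reality-based algebra (RBA) of rank $r$ is a complex algebra $A$ with a conjugate-linear involution $*$ satisfying $(xy)^*=y^*x^*$, together with a basis $\mathbf B=\{b_0=1,b_1,\dots,b_{r-1}\}$ such that $\mathbf B^*=\mathbf B$ (write $b_{i^*}=b_i^*$), the structure constants in $b_ib_j=\sum_k\lambda_{ijk}b_k$ are real, $\lambda_{ij0}\neq 0$ if and only if $j=i^*$, and $\lambda_{ii^*0}=\lambda_{i^*i0}>0$. A positive degree map is an algebra homomorphism $\delta:A\to\mathbb C$ with $\delta(a^*)=\overline{\delta(a)}$ for all $a\in A$ and $\delta(b_i)>0$ for all $i$; the basis is standard (with respect to $\delta$) if $\delta(b_i)=\lambda_{ii^*0}$ for all $i$. The order of a standard basis is $n=\sum_i\delta(b_i)$, and its standard feasible trace is $\tau(\sum_i\alpha_ib_i)=n\alpha_0$. Its character table consists of the values $\psi(b_i)$ of the irreducible characters $\psi$ of $A$ (with $\delta$ as first row, and rows of nondecreasing degree) and the multiplicities $m_\psi$ defined by $\tau=\sum_\psi m_\psi\psi$. Two standard bases $\mathbf B$, $\mathbf D$ are exactly isomorphic if some bijection $\mathbf B\to\mathbf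 D$ extends linearly to an algebra isomorphism. Corollary 3.4. Let $(A,\mathbf B)$ be a noncommutative RBA of rank $6$ with a positive degree map $\delta$. After rescaling the elements of $\mathbf B$ by positive numbers and renumbering them, $\mathbf B$ is standard with $b_0=1$, $b_i^*=b_i$ for $i=1,2,3$, and $b_4^*=b_5$. For bases normalized and numbered in this way, the possible character tables are precisely those of the form $$\begin{array}{r|cccccc|l} & b_0 & b_1 & b_2 & b_3 & b_4 & b_5 & \text{multiplicity}\\ \hline \delta & 1 & \delta_1 & \delta_2 & \delta_3 & \delta_4 & \delta_4 & 1\\ \phi & 1 & \phi_1 & \phi_2 & \phi_3 & \phi_4 & \phi_4 & m_\phi\\ \chi & 2 & \chi_1 & \chi_2 & \chi_3 & \chi_4 & \chi_4 & m_\chi \end{array}$$ where $\delta_1,\dots,\delta_4>0$ and $\phi_1,\dots,\phi_4$ are real numbers with $$1+\phi_1+\phi_2+\phi_3+2\phi_4=0,\qquad \frac{\phi_i}{\delta_i}\neq\frac{\phi_4}{\delta_4}\ \text{ for some } i\in\{1,2,3\},$$ and, with $\delta_0=\phi_0=1$, $\delta_5=\delta_4$, $\phi_5=\phi_4$ and $n=1+\delta_1+\delta_2+\delta_3+2\delta_4$,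 $$m_\phi=\frac{n}{\sum_{i=0}^5\phi_i^2/\delta_i},\qquad m_\chi=\frac{n-1-m_\phi}{2},\qquad \chi_i=\frac{-\delta_i-m_\phi\phi_i}{m_\chi}\quad(i=1,2,3,4).$$ That is, each such basis has exactly one character table and it is of this form; conversely, for all $\delta_i,\phi_i$ as above, $m_\phi$ and $m_\chi$ are positive and the table is the character table of some noncommutative RBA of rank $6$ with positive degree map. Moreover, the table determines the RBA up to exact isomorphism: any two standard bases, numbered as above, of noncommutative rank $6$ RBAs with the same character table are exactly isomorphic. -/

import Mathlib

open scoped BigOperators ComplexConjugate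

universe u v

namespace RBA

section Definitions

variable {A : Type u} [Ring A] [Algebra ℂ A] [StarRing A] [StarModule ℂ A] {r : ℕ} [NeZero r]

/-- The structure constant `λ_{ijk}`: the coefficient of `b_k` in `b_i * b_j`. -/
noncomputable def structConst (b : Module.Basis (Fin r) ℂ A) (i j k : Fin r) : ℂ :=
  b.repr (b i * b j) k

/-- `b = (b_0, …, b_{r-1})` is an RBA-basis of the complex algebra with (conjugate-linear)
involution `A`. The condition `star (b i) = b j` says `j = i^*`. -/
structure IsRBABasis (b : Module.Basis (Fin r) ℂ A) : Prop where
  zero_eq_one : b 0 = 1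
  real : ∀ i j k, (structConst b i j k).im = 0
  star_mem : ∀ i, ∃ j, star (b i) = b j
  ne_zero_iff : ∀ i j, structConst b i j 0 ≠ 0 ↔ star (b i) = b j
  symm_pos : ∀ i j, star (b i) = b j →
    structConst b i j 0 = structConst b j i 0 ∧ 0 < (structConst b i j 0).re

/-- `δ` is a positive degree map: a one-dimensional algebra homomorphism compatible with the
involution, with positive (real) values on the basis. -/
structure IsPositiveDegreeMap (b : Module.Basis (Fin r) ℂ A) (δ : A →ₐ[ℂ] ℂ) : Prop where
  map_star : ∀ a, δ (star a) = conj (δ a)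
  pos : ∀ i, (δ (b i)).im = 0 ∧ 0 < (δ (b i)).re

/-- `b` is a standard RBA^δ-basis: `δ (b_i) = λ_{i i^* 0}` for all `i`. -/
structure IsStandardRBABasis (b : Module.Basis (Fin r) ℂ A) (δ : A →ₐ[ℂ] ℂ) : Prop where
  isRBABasis : IsRBABasis b
  isPositiveDegreeMap : IsPositiveDegreeMap b δ
  standard : ∀ i j, star (b i) = b j → δ (b i) = structConst b i j 0

/-- The standard feasible trace `τ (∑ α_i b_i) = n α_0`, where `n = ∑ δ (b_i)` is the order. -/
noncomputable def standardTrace (b : Module.Basis (Fin r) ℂ A) (δ : A →ₐ[ℂ] ℂ) : A →ₗ[ℂ] ℂ :=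
  (∑ i, δ (b i)) • b.coord 0

/-- `ψ` is the character (trace function) of an irreducible matrix representation of `A` of some
degree `d > 0`. -/
def IsIrreducibleCharacter (ψ : A →ₗ[ℂ] ℂ) : Prop :=
  ∃ (d : ℕ) (ρ : A →ₐ[ℂ] Matrix (Fin d) (Fin d) ℂ),
    0 < d ∧
    (∀ W : Submodule ℂ (Fin d → ℂ),
      (∀ a : A, ∀ w ∈ W, (ρ a).mulVec w ∈ W) → W = ⊥ ∨ W = ⊤) ∧
    ∀ a, ψ a = (ρ a).trace

/-- `(T, m)` is the character table, with its column `m` of multiplicities, of the standard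
RBA^δ-basis `b`: the rows are the distinct irreducible characters `ψ_0, …, ψ_{s-1}` of `A`,
starting with `δ` and arranged by nondecreasing degree, `T k i = ψ_k (b_i)`, and the
multiplicities are the coefficients of the standard feasible trace in terms of the `ψ_k`. -/
def IsCharacterTable {s : ℕ} [NeZero s] (b : Module.Basis (Fin r) ℂ A) (δ : A →ₐ[ℂ] ℂ)
    (T : Matrix (Fin s) (Fin r) ℂ) (m : Fin s → ℂ) : Prop :=
  ∃ ψ : Fin s → (A →ₗ[ℂ] ℂ),
    Function.Injective ψ ∧
    Set.range ψ = {χ | IsIrreducibleCharacter χ} ∧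
    ψ 0 = δ.toLinearMap ∧
    (∀ k l, k ≤ l → (ψ k 1).re ≤ (ψ l 1).re) ∧
    (∀ k i, T k i = ψ k (b i)) ∧
    standardTrace b δ = ∑ k, m k • ψ k

/-- A standard RBA^δ-basis of rank 6 numbered so that `b_1, b_2, b_3` are fixed by the involution
and `b_4, b_5` are interchanged by it. -/
structure IsNumberedBasis (b : Module.Basis (Fin 6) ℂ A) (δ : A →ₐ[ℂ] ℂ) : Prop where
  isStandardRBABasis : IsStandardRBABasis b δ
  star_one : star (b 1) = b 1
  star_two : star (b 2) = b 2
  star_three : star (b 3) = b 3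
  star_four : star (b 4) = b 5

/-- `c` arises from `b` by positive rescaling and renumbering of the basis elements. -/
def IsRescaling (b c : Module.Basis (Fin r) ℂ A) : Prop :=
  ∃ (σ : Equiv.Perm (Fin r)) (t : Fin r → ℝ), ∀ i, 0 < t i ∧ c i = (t i : ℂ) • b (σ i)

/-- Exact isomorphism of standard bases: a bijection of the bases whose linear extension is an
algebra isomorphism. -/
def ExactlyIsomorphic {C : Type v} [Ring C] [Algebra ℂ C]
    (b : Module.Basis (Fin r) ℂ A) (c : Module.Basis (Fin r) ℂ C) : Prop :=
  ∃ (π : Equiv.Perm (Fin r)) (f : A ≃ₐ[ℂ] C), ∀ i, f (b i) = c (π i)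

end Definitions

/-- The conditions on the parameters `d i = δ_i` and `p i = φ_i`, with the conventions
`δ_0 = φ_0 = 1`, `δ_5 = δ_4`, `φ_5 = φ_4`. -/
structure Admissible (d p : Fin 6 → ℝ) : Prop where
  d_zero : d 0 = 1
  p_zero : p 0 = 1
  d_five : d 5 = d 4
  p_five : p 5 = p 4
  d_pos : ∀ i, 0 < d i
  sum_p : 1 + p 1 + p 2 + p 3 + 2 * p 4 = 0
  ratio : p 1 / d 1 ≠ p 4 / d 4 ∨ p 2 / d 2 ≠ p 4 / d 4 ∨ p 3 / d 3 ≠ p 4 / d 4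

noncomputable def order (d : Fin 6 → ℝ) : ℝ := 1 + d 1 + d 2 + d 3 + 2 * d 4

noncomputable def mPhi (d p : Fin 6 → ℝ) : ℝ := order d / ∑ i, p i ^ 2 / d i

noncomputable def mChi (d p : Fin 6 → ℝ) : ℝ := (order d - 1 - mPhi d p) / 2

noncomputable def chiVal (d p : Fin 6 → ℝ) (i : Fin 6) : ℝ :=
  if i = 0 then 2 else (-d i - mPhi d p * p i) / mChi d p

/-- The explicit table with rows `δ, φ, χ`. -/
noncomputable def table (d p : Fin 6 → ℝ) : Matrix (Fin 3) (Fin 6) ℂ :=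
  Matrix.of ![fun i => (d i : ℂ), fun i => (p i : ℂ), fun i => (chiVal d p i : ℂ)]

/-- The explicit column of multiplicities `1, m_φ, m_χ`. -/
noncomputable def mult (d p : Fin 6 → ℝ) : Fin 3 → ℂ :=
  ![1, (mPhi d p : ℂ), (mChi d p : ℂ)]

end RBA

namespace RBA

section Basics

variable {A : Type u} [Ring A] [Algebra ℂ A] [StarRing A] {r : ℕ} [NeZero r]
  {b : Module.Basis (Fin r) ℂ A}

/-- The index `i^*` with `b_i^* = b_{i^*}`. -/
noncomputable def IsRBABasis.adj (h : IsRBABasis b) (i : Fin r) : Fin r :=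
  Classical.choose (h.star_mem i)

theorem IsRBABasis.star_eq (h : IsRBABasis b) (i : Fin r) : star (b i) = b (h.adj i) :=
  Classical.choose_spec (h.star_mem i)

theorem IsRBABasis.adj_eq_iff (h : IsRBABasis b) {i j : Fin r} :
    h.adj i = j ↔ star (b i) = b j := by
  rw [h.star_eq i]
  exact b.injective.eq_iff.symm

theorem IsRBABasis.adj_adj (h : IsRBABasis b) (i : Fin r) : h.adj (h.adj i) = i := by
  rw [h.adj_eq_iff, ← h.star_eq, star_star]

theorem IsRBABasis.adj_zero (h : IsRBABasis b) : h.adj 0 = 0 := by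
  rw [h.adj_eq_iff, h.zero_eq_one, star_one]

theorem IsRBABasis.structConst_zero_of_ne (h : IsRBABasis b) {i j : Fin r} (hij : j ≠ h.adj i) :
    structConst b i j 0 = 0 := by
  by_contra hne
  exact hij ((h.adj_eq_iff).2 ((h.ne_zero_iff i j).1 hne)).symm

/-- The weight `λ_{i i^* 0}`. -/
noncomputable def IsRBABasis.weight (h : IsRBABasis b) (i : Fin r) : ℝ :=
  (structConst b i (h.adj i) 0).re

theorem IsRBABasis.structConst_adj (h : IsRBABasis b) (i : Fin r) :
    structConst b i (h.adj i) 0 = (h.weight i : ℂ) := by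
  apply Complex.ext
  · simp [IsRBABasis.weight]
  · simpa using h.real i (h.adj i) 0

theorem IsRBABasis.weight_pos (h : IsRBABasis b) (i : Fin r) : 0 < h.weight i :=
  (h.symm_pos i _ (h.star_eq i)).2

theorem IsRBABasis.weight_adj (h : IsRBABasis b) (i : Fin r) :
    h.weight (h.adj i) = h.weight i := by
  unfold IsRBABasis.weight
  rw [h.adj_adj, (h.symm_pos i _ (h.star_eq i)).1]

theorem IsRBABasis.weight_zero (h : IsRBABasis b) : h.weight 0 = 1 := by
  unfold IsRBABasis.weight structConst
  rw [h.adj_zero, h.zero_eq_one, mul_one, ← h.zero_eq_one]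
  simp

theorem IsRBABasis.coord_mul_basis (h : IsRBABasis b) (i j : Fin r) :
    b.coord 0 (b i * b j) = if j = h.adj i then (h.weight i : ℂ) else 0 := by
  split_ifs with hij
  · subst hij
    exact h.structConst_adj i
  · exact h.structConst_zero_of_ne hij

theorem IsRBABasis.coord_mul_adj (h : IsRBABasis b) (x : A) (k : Fin r) :
    b.coord 0 (x * b (h.adj k)) = b.repr x k * h.weight k := by
  conv_lhs => rw [← b.sum_repr x]
  rw [Finset.sum_mul, map_sum, Finset.sum_eq_single k]
  · rw [smul_mul_assoc, map_smul, h.coord_mul_basis, if_pos rfl, smul_eq_mul]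
  · intro j _ hj
    rw [smul_mul_assoc, map_smul, h.coord_mul_basis, if_neg, smul_zero]
    intro h'
    apply hj
    rw [← h.adj_adj j, ← h', h.adj_adj]
  · simp

theorem IsRBABasis.coord_mul_comm (h : IsRBABasis b) (x y : A) :
    b.coord 0 (x * y) = b.coord 0 (y * x) := by
  have key : (LinearMap.mul ℂ A).compr₂ (b.coord 0) =
      ((LinearMap.mul ℂ A).flip).compr₂ (b.coord 0) := by
    refine b.ext fun i => b.ext fun j => ?_
    simp only [LinearMap.compr₂_apply, LinearMap.flip_apply, LinearMap.mul_apply']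
    rw [h.coord_mul_basis, h.coord_mul_basis]
    by_cases hij : j = h.adj i
    · subst hij
      rw [if_pos rfl, if_pos (h.adj_adj i).symm, h.weight_adj]
    · rw [if_neg hij, if_neg]
      rintro rfl
      exact hij (h.adj_adj j).symm
  exact congrArg (fun f => f x y) key

theorem IsRBABasis.coord_mul_star_pos [StarModule ℂ A] (h : IsRBABasis b) {x : A} (hx : x ≠ 0) :
    0 < (b.coord 0 (x * star x)).re := by
  have e : b.coord 0 (x * star x) = ((∑ i, Complex.normSq (b.repr x i) * h.weight i : ℝ) : ℂ) := by
    have : star x = ∑ i, conj (b.repr x i) • b (h.adj i) := by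
      conv_lhs => rw [← b.sum_repr x]
      rw [star_sum]
      refine Finset.sum_congr rfl fun i _ => ?_
      rw [star_smul, h.star_eq]
      rfl
    rw [this, Finset.mul_sum, map_sum, Complex.ofReal_sum]
    refine Finset.sum_congr rfl fun i _ => ?_
    rw [mul_smul_comm, map_smul, h.coord_mul_adj, smul_eq_mul, ← mul_assoc, Complex.ofReal_mul,
      Complex.normSq_eq_conj_mul_self]
  rw [e, Complex.ofReal_re]
  obtain ⟨i, hi⟩ : ∃ i, b.repr x i ≠ 0 := by
    by_contra! hall
    exact hx (b.repr.map_eq_zero_iff.1 (Finsupp.ext hall))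
  refine Finset.sum_pos' (fun j _ => ?_) ⟨i, Finset.mem_univ _, ?_⟩
  · exact mul_nonneg (Complex.normSq_nonneg _) (h.weight_pos j).le
  · exact mul_pos (Complex.normSq_pos.2 hi) (h.weight_pos i)

theorem IsRBABasis.mul_star_ne_zero [StarModule ℂ A] (h : IsRBABasis b) {x : A} (hx : x ≠ 0) :
    x * star x ≠ 0 := by
  intro h0
  have := h.coord_mul_star_pos hx
  rw [h0] at this
  simp at this

theorem IsRBABasis.isSemisimpleRing [StarModule ℂ A] (h : IsRBABasis b) : IsSemisimpleRing A := by
  have : FiniteDimensional ℂ A := b.finiteDimensional_of_finite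
  have : IsArtinianRing A := IsArtinianRing.of_finite ℂ A
  rw [IsArtinianRing.isSemisimpleRing_iff_jacobson]
  rw [eq_bot_iff]
  intro x hx
  by_contra hx0
  obtain ⟨N, hN⟩ := IsArtinianRing.isNilpotent_jacobson_bot (R := A)
  have hmem : x * star x ∈ Ring.jacobson A := Ideal.mul_mem_right _ _ hx
  have hpow : ∀ k : ℕ, (x * star x) ^ (2 ^ k) ≠ 0 := by
    intro k
    induction k with
    | zero => simpa using h.mul_star_ne_zero hx0
    | succ k ih =>
      have hs : star ((x * star x) ^ (2 ^ k)) = (x * star x) ^ (2 ^ k) := by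
        rw [star_pow, star_mul, star_star]
      have := h.mul_star_ne_zero ih
      rwa [hs, ← pow_two, ← pow_mul, ← pow_succ] at this
  apply hpow N
  have h1 : (x * star x) ^ N = 0 := by
    have := Ideal.pow_mem_pow (I := Ideal.jacobson (⊥ : Ideal A))
      (by rwa [Ideal.jacobson_bot]) N (x := x * star x)
    rw [hN] at this
    exact this
  exact pow_eq_zero_of_le (Nat.lt_two_pow_self).le h1

/-- The linear anti-involution `b_i ↦ b_i^*`. -/
noncomputable def transposeMap (b : Module.Basis (Fin r) ℂ A) : A →ₗ[ℂ] A :=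
  b.constr ℂ fun i => star (b i)

omit [NeZero r] in
theorem transposeMap_basis (i : Fin r) : transposeMap b (b i) = star (b i) := by
  simp [transposeMap]

omit [StarRing A] [NeZero r] in
theorem basis_mul_basis (b : Module.Basis (Fin r) ℂ A) (i j : Fin r) :
    b i * b j = ∑ k, structConst b i j k • b k := (b.sum_repr _).symm

theorem IsRBABasis.conj_structConst (h : IsRBABasis b) (i j k : Fin r) :
    conj (structConst b i j k) = structConst b i j k :=
  Complex.conj_eq_iff_im.2 (h.real i j k)

theorem IsRBABasis.transposeMap_mul [StarModule ℂ A] (h : IsRBABasis b) (x y : A) :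
    transposeMap b (x * y) = transposeMap b y * transposeMap b x := by
  have key : (LinearMap.mul ℂ A).compr₂ (transposeMap b) =
      ((LinearMap.mul ℂ A).flip).compl₁₂ (transposeMap b) (transposeMap b) := by
    refine b.ext fun i => b.ext fun j => ?_
    simp only [LinearMap.compr₂_apply, LinearMap.compl₁₂_apply, LinearMap.flip_apply,
      LinearMap.mul_apply', transposeMap_basis]
    rw [← star_mul, basis_mul_basis, map_sum, star_sum]
    refine Finset.sum_congr rfl fun k _ => ?_
    rw [map_smul, transposeMap_basis, star_smul]
    congr 1
    exact (h.conj_structConst i j k).symm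
  exact congrArg (fun f => f x y) key

theorem IsRBABasis.transposeMap_one (h : IsRBABasis b) : transposeMap b 1 = 1 := by
  rw [← h.zero_eq_one, transposeMap_basis, h.zero_eq_one, star_one]

theorem IsRBABasis.coord_transposeMap (h : IsRBABasis b) (x : A) :
    b.coord 0 (transposeMap b x) = b.coord 0 x := by
  have key : b.coord 0 ∘ₗ transposeMap b = b.coord 0 := by
    refine b.ext fun i => ?_
    rw [LinearMap.comp_apply, transposeMap_basis, h.star_eq]
    simp only [Module.Basis.coord_apply, Module.Basis.repr_self, Finsupp.single_apply]
    congr 1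
    rw [h.adj_eq_iff, h.zero_eq_one, eq_iff_iff]
    constructor
    · intro h'
      apply b.injective
      rw [h.zero_eq_one, ← star_star (b i), h', star_one]
    · rintro rfl
      rw [h.zero_eq_one, star_one]
  exact congrArg (fun f => f x) key

end Basics

section Model

/-- The semisimple algebra `ℂ ⊕ ℂ ⊕ M₂(ℂ)`. -/
abbrev Model : Type := ℂ × ℂ × Matrix (Fin 2) (Fin 2) ℂ

/-- The matrix units of the noncommutative summand. -/
def Model.unit (i j : Fin 2) : Model := (0, 0, Matrix.single i j 1)

theorem Model.unit_mul_unit (i j k : Fin 2) :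
    Model.unit i j * Model.unit j k = Model.unit i k := by
  simp [Model.unit]

theorem Model.unit_mul_unit_of_ne (i : Fin 2) {j k : Fin 2} (l : Fin 2) (h : j ≠ k) :
    Model.unit i j * Model.unit k l = 0 := by
  simp [Model.unit, h]

theorem Model.eq_smul_add (x : Model) :
    x = x.1 • ((1, 0, 0) : Model) + x.2.1 • ((0, 1, 0) : Model)
      + x.2.2 0 0 • Model.unit 0 0 + x.2.2 0 1 • Model.unit 0 1
      + x.2.2 1 0 • Model.unit 1 0 + x.2.2 1 1 • Model.unit 1 1 := by
  refine Prod.ext (by simp [Model.unit]) (Prod.ext (by simp [Model.unit]) ?_)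
  ext i j
  fin_cases i <;> fin_cases j <;> simp [Model.unit]

theorem Model.map_eq {V : Type*} [AddCommGroup V] [Module ℂ V] (ψ : Model →ₗ[ℂ] V) (x : Model) :
    ψ x = x.1 • ψ (1, 0, 0) + x.2.1 • ψ (0, 1, 0)
      + x.2.2 0 0 • ψ (Model.unit 0 0) + x.2.2 0 1 • ψ (Model.unit 0 1)
      + x.2.2 1 0 • ψ (Model.unit 1 0) + x.2.2 1 1 • ψ (Model.unit 1 1) := by
  conv_lhs => rw [Model.eq_smul_add x]
  simp only [map_add, map_smul]

theorem Model.algHom_eq (ψ : Model →ₐ[ℂ] ℂ) : (∀ x, ψ x = x.1) ∨ (∀ x, ψ x = x.2.1) := by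
  have hne : ∀ i j : Fin 2, i ≠ j → ψ (Model.unit i j) = 0 := by
    intro i j hij
    apply mul_self_eq_zero.1
    rw [← map_mul, Model.unit_mul_unit_of_ne i j hij.symm, map_zero]
  have h01 := hne 0 1 (by decide)
  have h10 := hne 1 0 (by decide)
  have h00 : ψ (Model.unit 0 0) = 0 := by
    rw [← Model.unit_mul_unit 0 1 0, map_mul, h01, zero_mul]
  have h11 : ψ (Model.unit 1 1) = 0 := by
    rw [← Model.unit_mul_unit 1 0 1, map_mul, h01, mul_zero]
  have hx : ∀ x, ψ x = x.1 * ψ (1, 0, 0) + x.2.1 * ψ (0, 1, 0) := by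
    intro x
    have := Model.map_eq ψ.toLinearMap x
    simpa [h01, h10, h00, h11] using this
  have h1 : ψ (1, 0, 0) + ψ (0, 1, 0) = 1 := by
    have := hx 1
    simpa using this.symm
  have h12 : ψ (1, 0, 0) * ψ (0, 1, 0) = 0 := by
    rw [← map_mul]
    simp [← Prod.zero_eq_mk]
  rcases mul_eq_zero.1 h12 with h | h
  · right
    intro x
    rw [h, zero_add] at h1
    rw [hx, h, h1]
    simp
  · left
    intro x
    rw [h, add_zero] at h1
    rw [hx, h, h1]
    simp

theorem Model.linear_eq_of_mul_comm {t : Model →ₗ[ℂ] ℂ} (ht : ∀ x y, t (x * y) = t (y * x))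
    (x : Model) : t x = t (1, 0, 0) * x.1 + t (0, 1, 0) * x.2.1
      + t (Model.unit 0 0) * x.2.2.trace := by
  have hne : ∀ i j : Fin 2, i ≠ j → t (Model.unit i j) = 0 := by
    intro i j hij
    rw [← Model.unit_mul_unit i i j, ht, Model.unit_mul_unit_of_ne i i hij.symm, map_zero]
  have h11 : t (Model.unit 1 1) = t (Model.unit 0 0) := by
    rw [← Model.unit_mul_unit 1 0 1, ht, Model.unit_mul_unit]
  rw [Model.map_eq, hne 0 1 (by decide), hne 1 0 (by decide), h11, Matrix.trace_fin_two]
  simp only [smul_eq_mul]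
  ring

theorem Model.finrank : Module.finrank ℂ Model = 6 := by
  simp [Module.finrank_prod, Module.finrank_matrix]

end Model

section Wedderburn

/-- Matrices of size one are scalars. -/
noncomputable def oneMatrixEquiv : Matrix (Fin 1) (Fin 1) ℂ ≃ₐ[ℂ] ℂ :=
  AlgEquiv.ofBijective
    (AlgHom.ofLinearMap (Matrix.traceLinearMap (Fin 1) ℂ ℂ) (by simp)
      (by intro x y; simp [Matrix.trace_fin_one, Matrix.mul_apply]) : Matrix (Fin 1) (Fin 1) ℂ →ₐ[ℂ] ℂ)
    (by
      constructor
      · intro x y hxy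
        have h : x 0 0 = y 0 0 := by simpa [Matrix.trace_fin_one] using hxy
        ext i j
        rwa [Subsingleton.elim i 0, Subsingleton.elim j 0]
      · intro z
        exact ⟨Matrix.of fun _ _ => z, by simp [Matrix.trace_fin_one]⟩)

theorem trace_oneMatrixEquiv_symm (z : ℂ) : (oneMatrixEquiv.symm z).trace = z :=
  oneMatrixEquiv.apply_symm_apply z

theorem exists_algEquiv_model {A : Type u} [Ring A] [Algebra ℂ A] [IsSemisimpleRing A]
    (hA : Module.finrank ℂ A = 6) (hnc : ∃ x y : A, x * y ≠ y * x) (δ : A →ₐ[ℂ] ℂ) :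
    ∃ f : A ≃ₐ[ℂ] Model, ∀ a, (f a).1 = δ a := by
  have : FiniteDimensional ℂ A := Module.finite_of_finrank_pos (by omega)
  obtain ⟨n, d, hd, ⟨g⟩⟩ := IsSemisimpleRing.exists_algEquiv_pi_matrix_of_isAlgClosed ℂ A
  have hsum : ∑ i, d i * d i = 6 := by
    have := g.toLinearEquiv.finrank_eq
    rw [hA, Module.finrank_pi_fintype] at this
    simpa [Module.finrank_matrix] using this.symm
  have hdpos : ∀ i, 1 ≤ d i := fun i => Nat.one_le_iff_ne_zero.2 (hd i).out
  obtain ⟨i₀, hi₀⟩ : ∃ i, 2 ≤ d i := by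
    by_contra! hall
    obtain ⟨x, y, hxy⟩ := hnc
    apply hxy
    apply g.injective
    rw [map_mul, map_mul]
    funext i
    have hdi : d i = 1 := by have := hall i; have := hdpos i; omega
    have : Subsingleton (Fin (d i)) := by rw [hdi]; infer_instance
    ext k l
    simp only [Pi.mul_apply, Matrix.mul_apply]
    refine Finset.sum_congr rfl fun j _ => ?_
    rw [Subsingleton.elim j k, Subsingleton.elim l k]
    exact mul_comm _ _
  have hsplit : d i₀ * d i₀ + ∑ i ∈ Finset.univ.erase i₀, d i * d i = 6 := by
    rw [Finset.add_sum_erase _ (fun i => d i * d i) (Finset.mem_univ i₀), hsum]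
  have hd₀ : d i₀ = 2 := by
    have : d i₀ * d i₀ ≤ 6 := by omega
    nlinarith
  rw [hd₀] at hsplit
  have hrest : ∑ i ∈ Finset.univ.erase i₀, d i * d i = 2 := by omega
  have hone : ∀ i, i ≠ i₀ → d i = 1 := by
    intro i hi
    have : d i * d i ≤ 2 := by
      rw [← hrest]
      exact Finset.single_le_sum (f := fun i => d i * d i) (fun _ _ => Nat.zero_le _)
        (Finset.mem_erase.2 ⟨hi, Finset.mem_univ _⟩)
    have := hdpos i
    nlinarith
  have hcard : (Finset.univ.erase i₀).card = 2 := by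
    rw [← hrest, Finset.card_eq_sum_ones]
    refine Finset.sum_congr rfl fun i hi => ?_
    rw [hone i (Finset.ne_of_mem_erase hi)]
  obtain ⟨i₁, i₂, h12, hset⟩ := Finset.card_eq_two.1 hcard
  have hd₁ : d i₁ = 1 := hone i₁ (Finset.ne_of_mem_erase (by rw [hset]; simp))
  have hd₂ : d i₂ = 1 := hone i₂ (Finset.ne_of_mem_erase (by rw [hset]; simp))
  have hcases : ∀ i, i = i₀ ∨ i = i₁ ∨ i = i₂ := by
    intro i
    by_cases hi : i = i₀
    · exact Or.inl hi
    · right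
      have : i ∈ Finset.univ.erase i₀ := Finset.mem_erase.2 ⟨hi, Finset.mem_univ _⟩
      rw [hset] at this
      simpa using this
  let proj (i : Fin n) : A →ₐ[ℂ] Matrix (Fin (d i)) (Fin (d i)) ℂ :=
    (Pi.evalAlgHom ℂ _ i).comp g.toAlgHom
  let e₀ : Matrix (Fin (d i₀)) (Fin (d i₀)) ℂ ≃ₐ[ℂ] Matrix (Fin 2) (Fin 2) ℂ :=
    Matrix.reindexAlgEquiv ℂ ℂ (finCongr hd₀)
  let e₁ : Matrix (Fin (d i₁)) (Fin (d i₁)) ℂ ≃ₐ[ℂ] ℂ :=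
    (Matrix.reindexAlgEquiv ℂ ℂ (finCongr hd₁)).trans oneMatrixEquiv
  let e₂ : Matrix (Fin (d i₂)) (Fin (d i₂)) ℂ ≃ₐ[ℂ] ℂ :=
    (Matrix.reindexAlgEquiv ℂ ℂ (finCongr hd₂)).trans oneMatrixEquiv
  let F : A →ₐ[ℂ] Model := AlgHom.prod (e₁.toAlgHom.comp (proj i₁))
    (AlgHom.prod (e₂.toAlgHom.comp (proj i₂)) (e₀.toAlgHom.comp (proj i₀)))
  have hFinj : Function.Injective F := by
    intro x y hxy
    apply g.injective
    have h1 : e₁ (g x i₁) = e₁ (g y i₁) := congrArg (fun z : Model => z.1) hxy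
    have h2 : e₂ (g x i₂) = e₂ (g y i₂) := congrArg (fun z : Model => z.2.1) hxy
    have h0 : e₀ (g x i₀) = e₀ (g y i₀) := congrArg (fun z : Model => z.2.2) hxy
    funext i
    rcases hcases i with rfl | rfl | rfl
    · exact e₀.injective h0
    · exact e₁.injective h1
    · exact e₂.injective h2
  have hFbij : Function.Bijective F :=
    ⟨hFinj, (LinearMap.injective_iff_surjective_of_finrank_eq_finrank
      (f := F.toLinearMap) (by rw [hA, Model.finrank])).1 hFinj⟩
  let f : A ≃ₐ[ℂ] Model := AlgEquiv.ofBijective F hFbij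
  rcases Model.algHom_eq (δ.comp f.symm.toAlgHom) with h | h
  · refine ⟨f, fun a => ?_⟩
    have := h (f a)
    simpa using this.symm
  · let s : Model →ₐ[ℂ] Model := AlgHom.prod
      ((AlgHom.fst ℂ ℂ _).comp (AlgHom.snd ℂ ℂ _))
      (AlgHom.prod (AlgHom.fst ℂ ℂ _) ((AlgHom.snd ℂ ℂ _).comp (AlgHom.snd ℂ ℂ _)))
    have hs : ∀ x, s (s x) = x := fun x => rfl
    refine ⟨f.trans (AlgEquiv.ofBijective s (Function.Involutive.bijective hs)), fun a => ?_⟩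
    have := h (f a)
    simp only [AlgHom.comp_apply] at this
    exact this.symm.trans (congrArg δ (f.symm_apply_apply a))

end Wedderburn

section Irreducible

variable {A : Type u} [Ring A] [Algebra ℂ A]

theorem map_eq_zero_or_one_of_central {d : ℕ} {ρ : A →ₐ[ℂ] Matrix (Fin d) (Fin d) ℂ}
    (hρ : ∀ W : Submodule ℂ (Fin d → ℂ),
      (∀ a : A, ∀ w ∈ W, (ρ a).mulVec w ∈ W) → W = ⊥ ∨ W = ⊤)
    {e : A} (he : e * e = e) (hc : ∀ a, a * e = e * a) :
    ρ e = 0 ∨ ρ e = 1 := by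
  have hW : ∀ a : A, ∀ w ∈ LinearMap.range (ρ e).mulVecLin,
      (ρ a).mulVec w ∈ LinearMap.range (ρ e).mulVecLin := by
    rintro a w ⟨v, rfl⟩
    refine ⟨(ρ a).mulVec v, ?_⟩
    simp only [Matrix.mulVecLin_apply, Matrix.mulVec_mulVec, ← map_mul, hc]
  rcases hρ _ hW with h | h
  · left
    rw [LinearMap.range_eq_bot] at h
    exact Matrix.ext_iff_mulVec.2 fun v => by
      simpa using LinearMap.congr_fun h v
  · right
    refine Matrix.ext_iff_mulVec.2 fun v => ?_
    have hv : v ∈ LinearMap.range (ρ e).mulVecLin := by rw [h]; trivial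
    obtain ⟨w, rfl⟩ := hv
    rw [Matrix.mulVecLin_apply, Matrix.mulVec_mulVec, ← map_mul, he, Matrix.one_mulVec]

theorem finrank_le_card_of_invariant_span {d : ℕ}
    {ρ : A →ₐ[ℂ] Matrix (Fin d) (Fin d) ℂ}
    (hρ : ∀ W : Submodule ℂ (Fin d → ℂ),
      (∀ a : A, ∀ w ∈ W, (ρ a).mulVec w ∈ W) → W = ⊥ ∨ W = ⊤)
    {S : Finset (Fin d → ℂ)} {v : Fin d → ℂ} (hv : v ∈ S) (hv0 : v ≠ 0)
    (hS : ∀ a, ∀ w ∈ S, (ρ a).mulVec w ∈ Submodule.span ℂ (S : Set (Fin d → ℂ))) :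
    d ≤ S.card := by
  have hW : ∀ a : A, ∀ w ∈ Submodule.span ℂ (S : Set (Fin d → ℂ)),
      (ρ a).mulVec w ∈ Submodule.span ℂ (S : Set (Fin d → ℂ)) := by
    intro a w hw
    have : Submodule.span ℂ (S : Set (Fin d → ℂ)) ≤
        (Submodule.span ℂ (S : Set (Fin d → ℂ))).comap (ρ a).mulVecLin :=
      Submodule.span_le.2 fun w hw => hS a w hw
    exact this hw
  rcases hρ _ hW with h | h
  · exact absurd (Submodule.span_eq_bot.1 h v hv) hv0
  · have := finrank_span_finset_le_card (R := ℂ) S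
    rw [Set.finrank, h, finrank_top] at this
    simpa using this

theorem Model.trace_of_irreducible {d : ℕ} (hd : 0 < d)
    {ρ : Model →ₐ[ℂ] Matrix (Fin d) (Fin d) ℂ}
    (hρ : ∀ W : Submodule ℂ (Fin d → ℂ),
      (∀ a : Model, ∀ w ∈ W, (ρ a).mulVec w ∈ W) → W = ⊥ ∨ W = ⊤) :
    (∀ x, (ρ x).trace = x.1) ∨ (∀ x, (ρ x).trace = x.2.1) ∨
      (∀ x, (ρ x).trace = x.2.2.trace) := by
  have : NeZero d := ⟨hd.ne'⟩
  have hone : ∀ (l : Model →ₗ[ℂ] ℂ), (∀ x, ρ x = l x • 1) → ∀ x, (ρ x).trace = l x := by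
    intro l hl x
    have hd1 : d ≤ 1 := by
      have := finrank_le_card_of_invariant_span hρ (S := {fun _ => 1}) (v := fun _ => 1)
        (by simp) (fun h => one_ne_zero (congrFun h 0)) (by
          intro a w hw
          rw [hl, Matrix.smul_mulVec, Matrix.one_mulVec]
          exact Submodule.smul_mem _ _ (Submodule.subset_span hw))
      simpa using this
    obtain rfl : d = 1 := by omega
    rw [hl]
    simp
  have h3 : ρ (0, 0, 1) = 0 ∨ ρ (0, 0, 1) = 1 :=
    map_eq_zero_or_one_of_central hρ (by simp) (fun a => Prod.ext (by simp) (Prod.ext (by simp) (by simp)))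
  have h2 : ρ (0, 1, 0) = 0 ∨ ρ (0, 1, 0) = 1 :=
    map_eq_zero_or_one_of_central hρ (by simp) (fun a => Prod.ext (by simp) (Prod.ext (by simp) (by simp)))
  rcases h3 with h3 | h3
  · have hx : ∀ x : Model, ρ x = x.1 • ρ (1, 0, 0) + x.2.1 • ρ (0, 1, 0) := by
      intro x
      have hxe : x = x.1 • ((1, 0, 0) : Model) + x.2.1 • ((0, 1, 0) : Model) + (0, 0, 1) * x := by
        refine Prod.ext (by simp) (Prod.ext (by simp) (by simp))
      conv_lhs => rw [hxe]
      rw [map_add, map_add, map_mul, h3, zero_mul, add_zero, map_smul, map_smul]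
    have h1 : ρ (1, 0, 0) + ρ (0, 1, 0) = 1 := by simpa using (hx 1).symm
    rcases h2 with h2 | h2
    · left
      refine hone (LinearMap.fst ℂ ℂ _) fun x => ?_
      rw [h2, add_zero] at h1
      simp [hx x, h1, h2]
    · right; left
      refine hone ((LinearMap.fst ℂ ℂ _).comp (LinearMap.snd ℂ ℂ _)) fun x => ?_
      rw [h2, add_eq_right] at h1
      simp [hx x, h1, h2]
  · right; right
    have h1 : ρ (1, 0, 0) = 0 := by
      rw [← mul_one (ρ (1, 0, 0)), ← h3, ← map_mul]
      simp [← Prod.zero_eq_mk]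
    have h2' : ρ (0, 1, 0) = 0 := by
      rw [← mul_one (ρ (0, 1, 0)), ← h3, ← map_mul]
      simp [← Prod.zero_eq_mk]
    have htr : ∀ x, (ρ x).trace = (ρ (Model.unit 0 0)).trace * x.2.2.trace := by
      intro x
      have := Model.linear_eq_of_mul_comm
        (t := (Matrix.traceLinearMap (Fin d) ℂ ℂ).comp ρ.toLinearMap)
        (fun x y => by simpa using Matrix.trace_mul_comm _ _) x
      simpa [h1, h2'] using this
    have hd2 : d ≤ 2 := by
      have hne : ρ (Model.unit 0 0) ≠ 0 := by
        intro h0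
        have h11 : ρ (Model.unit 1 1) = 0 := by
          rw [← Model.unit_mul_unit 1 0 1, ← Model.unit_mul_unit 0 0 1, map_mul, map_mul, h0,
            zero_mul, mul_zero]
        have : ((0, 0, 1) : Model) = Model.unit 0 0 + Model.unit 1 1 := by
          refine Prod.ext (by simp [Model.unit]) (Prod.ext (by simp [Model.unit]) ?_)
          ext i j
          fin_cases i <;> fin_cases j <;> simp [Model.unit]
        rw [this, map_add, h0, h11, add_zero] at h3
        exact zero_ne_one h3
      obtain ⟨u, hu⟩ : ∃ u, (ρ (Model.unit 0 0)).mulVec u ≠ 0 := by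
        by_contra! hall
        exact hne (Matrix.ext_iff_mulVec.2 fun v => by rw [hall, Matrix.zero_mulVec])
      have hmul : ∀ (x : Model) (i : Fin 2), x * Model.unit i 0
          = x.2.2 0 i • Model.unit 0 0 + x.2.2 1 i • Model.unit 1 0 := by
        intro x i
        refine Prod.ext (by simp [Model.unit]) (Prod.ext (by simp [Model.unit]) ?_)
        ext k l
        fin_cases i <;> fin_cases k <;> fin_cases l <;>
          simp [Model.unit, Matrix.mul_apply, Fin.sum_univ_two]
      classical
      refine (finrank_le_card_of_invariant_span hρ
        (S := {(ρ (Model.unit 0 0)).mulVec u, (ρ (Model.unit 1 0)).mulVec u})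
        (by simp) hu ?_).trans Finset.card_le_two
      have hmem : ∀ (a : Model) (i : Fin 2), (ρ a).mulVec ((ρ (Model.unit i 0)).mulVec u) ∈
          Submodule.span ℂ ((({(ρ (Model.unit 0 0)).mulVec u,
            (ρ (Model.unit 1 0)).mulVec u} : Finset (Fin d → ℂ))) : Set (Fin d → ℂ)) := by
        intro a i
        rw [Matrix.mulVec_mulVec, ← map_mul, hmul, map_add, map_smul, map_smul, Matrix.add_mulVec,
          Matrix.smul_mulVec, Matrix.smul_mulVec]
        exact Submodule.add_mem _ (Submodule.smul_mem _ _ (Submodule.subset_span (by simp)))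
          (Submodule.smul_mem _ _ (Submodule.subset_span (by simp)))
      intro a w hw
      rw [Finset.mem_insert, Finset.mem_singleton] at hw
      rcases hw with rfl | rfl
      · exact hmem a 0
      · exact hmem a 1
    have hd1 : d ≠ 1 := by
      rintro rfl
      have := Model.algHom_eq (oneMatrixEquiv.toAlgHom.comp ρ)
      have h30 : oneMatrixEquiv (ρ (0, 0, 1)) = 0 := by
        rcases this with h | h <;> simpa using h (0, 0, 1)
      rw [h3, map_one] at h30
      exact one_ne_zero h30
    obtain rfl : d = 2 := by omega
    have h2c := htr 1
    rw [map_one] at h2c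
    have hc : (ρ (Model.unit 0 0)).trace = 1 := by
      simp only [Matrix.trace_one, Fintype.card_fin, Prod.snd_one] at h2c
      have h2 : ((2 : ℕ) : ℂ) ≠ 0 := by norm_num
      field_simp at h2c
      exact h2c.symm
    intro x
    rw [htr, hc, one_mul]

/-- The characters of an algebra identified with `ℂ ⊕ ℂ ⊕ M₂(ℂ)`. -/
noncomputable def modelChar (f : A ≃ₐ[ℂ] Model) : Fin 3 → (A →ₗ[ℂ] ℂ) :=
  ![(LinearMap.fst ℂ ℂ _).comp f.toLinearMap,
    ((LinearMap.fst ℂ ℂ _).comp (LinearMap.snd ℂ ℂ _)).comp f.toLinearMap,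
    ((Matrix.traceLinearMap (Fin 2) ℂ ℂ).comp ((LinearMap.snd ℂ ℂ _).comp
      (LinearMap.snd ℂ ℂ _))).comp f.toLinearMap]

theorem modelChar_zero (f : A ≃ₐ[ℂ] Model) (a : A) : modelChar f 0 a = (f a).1 := rfl

theorem modelChar_one (f : A ≃ₐ[ℂ] Model) (a : A) : modelChar f 1 a = (f a).2.1 := rfl

theorem modelChar_two (f : A ≃ₐ[ℂ] Model) (a : A) : modelChar f 2 a = (f a).2.2.trace := rfl

theorem isIrreducibleCharacter_of_algHom (l : A →ₐ[ℂ] ℂ) :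
    IsIrreducibleCharacter l.toLinearMap := by
  refine ⟨1, oneMatrixEquiv.symm.toAlgHom.comp l, one_pos, fun W _ => ?_,
    fun a => (trace_oneMatrixEquiv_symm (l a)).symm⟩
  have : IsSimpleModule ℂ (Fin 1 → ℂ) := isSimpleModule_iff_finrank_eq_one.2 (by simp)
  exact eq_bot_or_eq_top W

theorem isIrreducibleCharacter_modelChar (f : A ≃ₐ[ℂ] Model) (k : Fin 3) :
    IsIrreducibleCharacter (modelChar f k) := by
  fin_cases k
  · exact isIrreducibleCharacter_of_algHom ((AlgHom.fst ℂ ℂ _).comp f.toAlgHom)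
  · exact isIrreducibleCharacter_of_algHom
      (((AlgHom.fst ℂ ℂ _).comp (AlgHom.snd ℂ ℂ _)).comp f.toAlgHom)
  · refine ⟨2, ((AlgHom.snd ℂ ℂ _).comp (AlgHom.snd ℂ ℂ _)).comp f.toAlgHom, two_pos,
      fun W hW => ?_, fun a => rfl⟩
    by_cases hbot : W = ⊥
    · exact Or.inl hbot
    right
    obtain ⟨w, hw, hw0⟩ := W.exists_mem_ne_zero_of_ne_bot hbot
    obtain ⟨i, hi⟩ : ∃ i, w i ≠ 0 := by
      by_contra! hall
      exact hw0 (funext hall)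
    rw [eq_top_iff]
    intro v _
    have := hW (f.symm (0, 0, Matrix.of fun k j => if j = i then v k / w i else 0)) w hw
    convert this using 1
    funext k
    simp [Matrix.mulVec, dotProduct, hi]

theorem isIrreducibleCharacter_iff (f : A ≃ₐ[ℂ] Model) (ψ : A →ₗ[ℂ] ℂ) :
    IsIrreducibleCharacter ψ ↔ ∃ k, modelChar f k = ψ := by
  constructor
  · rintro ⟨d, ρ, hd, hρ, hψ⟩
    have hρ' : ∀ W : Submodule ℂ (Fin d → ℂ),
        (∀ a : Model, ∀ w ∈ W, ((ρ.comp f.symm.toAlgHom) a).mulVec w ∈ W) → W = ⊥ ∨ W = ⊤ := by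
      intro W hW
      refine hρ W fun a w hw => ?_
      have := hW (f a) w hw
      simpa using this
    have key : ∀ k, (∀ x, ((ρ.comp f.symm.toAlgHom) x).trace = modelChar f k (f.symm x)) →
        modelChar f k = ψ := by
      intro k hk
      ext a
      have := hk (f a)
      rw [hψ]
      simpa using this.symm
    rcases Model.trace_of_irreducible hd hρ' with h | h | h
    · exact ⟨0, key 0 fun x => by rw [h, modelChar_zero, f.apply_symm_apply]⟩
    · exact ⟨1, key 1 fun x => by rw [h, modelChar_one, f.apply_symm_apply]⟩
    · exact ⟨2, key 2 fun x => by rw [h, modelChar_two, f.apply_symm_apply]⟩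
  · rintro ⟨k, rfl⟩
    exact isIrreducibleCharacter_modelChar f k

theorem linearIndependent_modelChar (f : A ≃ₐ[ℂ] Model) :
    LinearIndependent ℂ (modelChar f) := by
  rw [Fintype.linearIndependent_iff]
  intro g hg
  have h := fun x => LinearMap.congr_fun hg (f.symm x)
  simp only [Fin.sum_univ_three, LinearMap.add_apply, LinearMap.smul_apply, modelChar_zero,
    modelChar_one, modelChar_two, f.apply_symm_apply, LinearMap.zero_apply, smul_eq_mul] at h
  intro k
  fin_cases k
  · simpa using h (1, 0, 0)
  · simpa using h (0, 1, 0)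
  · simpa [Model.unit] using h (Model.unit 0 0)

theorem range_modelChar (f : A ≃ₐ[ℂ] Model) :
    Set.range (modelChar f) = {χ | IsIrreducibleCharacter χ} := by
  ext ψ
  exact (isIrreducibleCharacter_iff f ψ).symm

theorem modelChar_zero_eq {δ : A →ₐ[ℂ] ℂ} {f : A ≃ₐ[ℂ] Model} (hf : ∀ a, (f a).1 = δ a) : modelChar f 0 = δ.toLinearMap :=
  LinearMap.ext hf

theorem modelChar_apply_one (f : A ≃ₐ[ℂ] Model) (k : Fin 3) :
    modelChar f k 1 = ![1, 1, 2] k := by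
  fin_cases k
  · simp [modelChar_zero]
  · simp [modelChar_one]
  · simp [modelChar_two]

theorem algHom_eq_modelChar (f : A ≃ₐ[ℂ] Model) (l : A →ₐ[ℂ] ℂ) :
    l.toLinearMap = modelChar f 0 ∨ l.toLinearMap = modelChar f 1 := by
  rcases Model.algHom_eq (l.comp f.symm.toAlgHom) with h | h
  · left
    ext a
    rw [modelChar_zero, ← h]
    simp
  · right
    ext a
    rw [modelChar_one, ← h]
    simp

theorem modelChar_one_mul (f : A ≃ₐ[ℂ] Model) (x y : A) :
    modelChar f 1 (x * y) = modelChar f 1 x * modelChar f 1 y := by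
  simp [modelChar_one]

theorem modelChar_one_ne_zero (f : A ≃ₐ[ℂ] Model) : modelChar f 1 ≠ modelChar f 0 :=
  (linearIndependent_modelChar f).injective.ne (by decide)

/-- The elements of the algebra dual to the characters: the identities of the one-dimensional
summands, and the identity of the noncommutative summand. -/
noncomputable def centralIdempotent (f : A ≃ₐ[ℂ] Model) : Fin 3 → A :=
  ![f.symm (1, 0, 0), f.symm (0, 1, 0), f.symm (0, 0, 1)]

theorem modelChar_centralIdempotent_mul (f : A ≃ₐ[ℂ] Model) (k l : Fin 3) (x : A) :
    modelChar f l (centralIdempotent f k * x) = if k = l then modelChar f k x else 0 := by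
  fin_cases k <;> fin_cases l <;>
    simp [centralIdempotent, modelChar_zero, modelChar_one, modelChar_two]

end Irreducible

section Table

variable {A : Type u} [Ring A] [Algebra ℂ A] [StarRing A] {r : ℕ} [NeZero r]
  {b : Module.Basis (Fin r) ℂ A} {δ : A →ₐ[ℂ] ℂ} {f : A ≃ₐ[ℂ] Model}

omit [StarRing A] in
theorem card_eq_three_of_isCharacterTable (f : A ≃ₐ[ℂ] Model) {s : ℕ} [NeZero s]
    {T : Matrix (Fin s) (Fin r) ℂ} {m : Fin s → ℂ} (h : IsCharacterTable b δ T m) : s = 3 := by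
  obtain ⟨ψ, hinj, hrange, -⟩ := h
  rw [← range_modelChar f] at hrange
  have h1 := Set.ncard_range_of_injective hinj
  have h2 := Set.ncard_range_of_injective (linearIndependent_modelChar f).injective
  rw [hrange, h2] at h1
  simpa using h1.symm

omit [StarRing A] in
theorem isCharacterTable_iff (hf : ∀ a, (f a).1 = δ a) {μ : Fin 3 → ℂ}
    (hμ : standardTrace b δ = ∑ k, μ k • modelChar f k)
    (T : Matrix (Fin 3) (Fin r) ℂ) (m : Fin 3 → ℂ) :
    IsCharacterTable b δ T m ↔ (∀ k i, T k i = modelChar f k (b i)) ∧ m = μ := by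
  constructor
  · rintro ⟨ψ, hinj, hrange, h0, hmono, hT, hm⟩
    rw [← range_modelChar f] at hrange
    have hψ : ψ = modelChar f := by
      have hmem : ∀ k, ∃ l, modelChar f l = ψ k := fun k => by
        have : ψ k ∈ Set.range ψ := ⟨k, rfl⟩
        rwa [hrange] at this
      choose g hg using hmem
      have hginj : Function.Injective g := fun k l hkl => hinj (by rw [← hg, ← hg, hkl])
      have hg0 : g 0 = 0 := by
        apply (linearIndependent_modelChar f).injective
        rw [hg, h0, modelChar_zero_eq hf]
      have hle := hmono 1 2 (by decide)
      rw [← hg, ← hg, modelChar_apply_one, modelChar_apply_one] at hle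
      have h10 : g 1 ≠ g 0 := hginj.ne (by decide)
      have h20 : g 2 ≠ g 0 := hginj.ne (by decide)
      have h12 : g 1 ≠ g 2 := hginj.ne (by decide)
      have : g 1 = 1 ∧ g 2 = 2 := by
        rw [hg0] at h10 h20
        generalize g 1 = x at *
        generalize g 2 = y at *
        fin_cases x <;> fin_cases y <;> simp_all
      funext k
      rw [← hg]
      fin_cases k
      · exact congrArg _ hg0
      · exact congrArg _ this.1
      · exact congrArg _ this.2
    subst hψ
    refine ⟨hT, ?_⟩
    rw [hm] at hμ
    exact funext ((linearIndependent_modelChar f).eq_coords_of_eq hμ)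
  · rintro ⟨hT, rfl⟩
    refine ⟨modelChar f, (linearIndependent_modelChar f).injective, range_modelChar f,
      modelChar_zero_eq hf, fun k l hkl => ?_, hT, hμ⟩
    rw [modelChar_apply_one, modelChar_apply_one]
    fin_cases k <;> fin_cases l <;> simp_all

omit [NeZero r] in
theorem IsPositiveDegreeMap.conj_eq (h : IsPositiveDegreeMap b δ) (i : Fin r) :
    conj (δ (b i)) = δ (b i) := Complex.conj_eq_iff_im.2 (h.pos i).1

omit [NeZero r] in
theorem IsPositiveDegreeMap.star_eq (h : IsPositiveDegreeMap b δ) (i : Fin r) :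
    δ (star (b i)) = δ (b i) := by rw [h.map_star, h.conj_eq]

theorem IsStandardRBABasis.weight_eq (h : IsStandardRBABasis b δ) (i : Fin r) :
    (h.isRBABasis.weight i : ℂ) = δ (b i) := by
  rw [h.standard i _ (h.isRBABasis.star_eq i), h.isRBABasis.structConst_adj]

end Table

section Characters

variable {A : Type u} [Ring A] [Algebra ℂ A] [StarRing A] [StarModule ℂ A] {r : ℕ} [NeZero r]
  {b : Module.Basis (Fin r) ℂ A} {δ : A →ₐ[ℂ] ℂ} {f : A ≃ₐ[ℂ] Model}

theorem IsRBABasis.modelChar_one_transposeMap (h : IsRBABasis b) (hδ : IsPositiveDegreeMap b δ)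
    (hf : ∀ a, (f a).1 = δ a) (x : A) :
    modelChar f 1 (transposeMap b x) = modelChar f 1 x := by
  let l : A →ₐ[ℂ] ℂ := AlgHom.ofLinearMap ((modelChar f 1) ∘ₗ transposeMap b)
    (by rw [LinearMap.comp_apply, h.transposeMap_one, modelChar_apply_one]; rfl)
    (fun x y => by
      simp only [LinearMap.comp_apply]
      rw [h.transposeMap_mul, modelChar_one_mul, mul_comm])
  have hl : l.toLinearMap = (modelChar f 1) ∘ₗ transposeMap b := rfl
  rcases algHom_eq_modelChar f l with h' | h'
  · exfalso
    apply modelChar_one_ne_zero f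
    refine b.ext fun i => ?_
    have h1 := LinearMap.congr_fun h' (star (b i))
    rw [hl, LinearMap.comp_apply, h.star_eq, transposeMap_basis, ← h.star_eq, star_star] at h1
    rw [h1, modelChar_zero_eq hf]
    exact hδ.star_eq i
  · rw [hl] at h'
    exact LinearMap.congr_fun h' x

omit [StarModule ℂ A] in
theorem IsRBABasis.conj_modelChar_one (h : IsRBABasis b) (hδ : IsPositiveDegreeMap b δ)
    (hf : ∀ a, (f a).1 = δ a) (i : Fin r) :
    conj (modelChar f 1 (b i)) = modelChar f 1 (b i) := by
  let g : A →ₗ[ℂ] ℂ := b.constr ℂ fun i => conj (modelChar f 1 (b i))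
  have hg : ∀ i, g (b i) = conj (modelChar f 1 (b i)) := fun i => by simp [g]
  have hmul : ∀ x y, g (x * y) = g x * g y := by
    have key : (LinearMap.mul ℂ A).compr₂ g = (LinearMap.mul ℂ ℂ).compl₁₂ g g := by
      refine b.ext fun i => b.ext fun j => ?_
      simp only [LinearMap.compr₂_apply, LinearMap.compl₁₂_apply, LinearMap.mul_apply', hg]
      rw [← map_mul (starRingEnd ℂ), ← modelChar_one_mul, basis_mul_basis, map_sum, map_sum, map_sum]
      refine Finset.sum_congr rfl fun k _ => ?_
      rw [map_smul, map_smul, hg, smul_eq_mul, smul_eq_mul, map_mul, h.conj_structConst]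
    intro x y
    exact congrArg (fun f => f x y) key
  have hone : g 1 = 1 := by
    rw [← h.zero_eq_one, hg, h.zero_eq_one, modelChar_apply_one]
    simp
  rcases algHom_eq_modelChar f (AlgHom.ofLinearMap g hone hmul) with h' | h'
  · exfalso
    apply modelChar_one_ne_zero f
    refine b.ext fun i => ?_
    have h1 : g (b i) = modelChar f 0 (b i) := LinearMap.congr_fun h' (b i)
    rw [hg, modelChar_zero_eq hf] at h1
    rw [modelChar_zero_eq hf, ← Complex.conj_conj (modelChar f 1 (b i)), h1]
    exact hδ.conj_eq i
  · have h1 : g (b i) = modelChar f 1 (b i) := LinearMap.congr_fun h' (b i)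
    rwa [hg] at h1

theorem IsRBABasis.exists_coord_eq_sum (h : IsRBABasis b) (f : A ≃ₐ[ℂ] Model) :
    ∃ α : Fin 3 → ℂ, (∀ k, α k ≠ 0) ∧ b.coord 0 = ∑ k, α k • modelChar f k := by
  have ht := Model.linear_eq_of_mul_comm (t := b.coord 0 ∘ₗ f.symm.toLinearMap)
    (fun x y => by
      simp only [LinearMap.comp_apply, AlgEquiv.toLinearMap_apply, map_mul]
      exact h.coord_mul_comm _ _)
  obtain ⟨α, hα⟩ : ∃ α : Fin 3 → ℂ, b.coord 0 = ∑ k, α k • modelChar f k := by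
    refine ⟨![b.coord 0 (f.symm (1, 0, 0)), b.coord 0 (f.symm (0, 1, 0)),
      b.coord 0 (f.symm (Model.unit 0 0))], LinearMap.ext fun a => ?_⟩
    have := ht (f a)
    simp only [LinearMap.comp_apply, AlgEquiv.toLinearMap_apply, f.symm_apply_apply] at this
    rw [this]
    simp only [Fin.sum_univ_three, LinearMap.add_apply, LinearMap.smul_apply, modelChar_zero,
      modelChar_one, modelChar_two, smul_eq_mul]
    rfl
  refine ⟨α, fun k hk => ?_, hα⟩
  have he : ∀ x, b.coord 0 (centralIdempotent f k * x) = 0 := by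
    intro x
    rw [hα]
    simp only [LinearMap.sum_apply, LinearMap.smul_apply, modelChar_centralIdempotent_mul]
    simp [hk]
  have he0 : centralIdempotent f k = 0 := by
    by_contra hne
    have := h.coord_mul_star_pos hne
    rw [he] at this
    simp at this
  have := modelChar_centralIdempotent_mul f k k 1
  rw [he0, zero_mul, map_zero, if_pos rfl, modelChar_apply_one] at this
  fin_cases k <;> simp at this

omit [StarModule ℂ A] in
theorem IsRBABasis.sum_mul_div_weight (h : IsRBABasis b) {α : Fin 3 → ℂ}
    (hα : b.coord 0 = ∑ k, α k • modelChar f k) (k l : Fin 3) :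
    ∑ i, α k * modelChar f k (star (b i)) * modelChar f l (b i) / h.weight i
      = if k = l then modelChar f k 1 else 0 := by
  rw [← modelChar_centralIdempotent_mul f k l 1, mul_one]
  conv_rhs => rw [← b.sum_repr (centralIdempotent f k)]
  rw [map_sum]
  refine Finset.sum_congr rfl fun i _ => ?_
  have := h.coord_mul_adj (centralIdempotent f k) i
  rw [hα] at this
  simp only [LinearMap.sum_apply, LinearMap.smul_apply, modelChar_centralIdempotent_mul,
    smul_eq_mul] at this
  rw [Finset.sum_eq_single k (fun j _ hj => by rw [if_neg hj.symm, mul_zero]) (by simp),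
    if_pos rfl, ← h.star_eq] at this
  rw [map_smul, this, smul_eq_mul]
  have hw : (h.weight i : ℂ) ≠ 0 := Complex.ofReal_ne_zero.2 (h.weight_pos i).ne'
  field_simp

end Characters

section Parameters

variable {d p : Fin 6 → ℝ}

theorem Admissible.sum_div (h : Admissible d p) : ∑ i, p i ^ 2 / d i =
    1 + p 1 ^ 2 / d 1 + p 2 ^ 2 / d 2 + p 3 ^ 2 / d 3 + 2 * (p 4 ^ 2 / d 4) := by
  simp only [Fin.sum_univ_six, h.d_zero, h.p_zero, h.d_five, h.p_five]
  ring

theorem Admissible.order_pos (h : Admissible d p) : 0 < order d := by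
  have := h.d_pos 1; have := h.d_pos 2; have := h.d_pos 3; have := h.d_pos 4
  unfold order; positivity

theorem Admissible.sum_div_pos (h : Admissible d p) : 0 < ∑ i, p i ^ 2 / d i := by
  rw [h.sum_div]
  have := h.d_pos 1; have := h.d_pos 2; have := h.d_pos 3; have := h.d_pos 4
  positivity

theorem Admissible.mPhi_pos (h : Admissible d p) : 0 < mPhi d p :=
  div_pos h.order_pos h.sum_div_pos

theorem Admissible.mChi_pos (h : Admissible d p) : 0 < mChi d p := by
  have h1 := h.d_pos 1; have h2 := h.d_pos 2; have h3 := h.d_pos 3; have h4 := h.d_pos 4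
  have hS := h.sum_div_pos
  suffices key : order d < (order d - 1) * ∑ i, p i ^ 2 / d i by
    have : mPhi d p < order d - 1 := (div_lt_iff₀ hS).2 key
    unfold mChi
    linarith
  rw [h.sum_div]
  have hr := h.ratio
  have hsum := h.sum_p
  unfold order
  obtain ⟨x1, e1⟩ : ∃ x, x = p 1 / d 1 := ⟨_, rfl⟩
  obtain ⟨x2, e2⟩ : ∃ x, x = p 2 / d 2 := ⟨_, rfl⟩
  obtain ⟨x3, e3⟩ : ∃ x, x = p 3 / d 3 := ⟨_, rfl⟩
  obtain ⟨x4, e4⟩ : ∃ x, x = p 4 / d 4 := ⟨_, rfl⟩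
  rw [← e1, ← e2, ← e3, ← e4] at hr
  rw [eq_div_iff h1.ne'] at e1
  rw [eq_div_iff h2.ne'] at e2
  rw [eq_div_iff h3.ne'] at e3
  rw [eq_div_iff h4.ne'] at e4
  rw [← e1, ← e2, ← e3, ← e4] at hsum ⊢
  have hsq : ∀ x t : ℝ, 0 < t → (x * t) ^ 2 / t = x ^ 2 * t := fun x t ht => by
    field_simp
  rw [hsq _ _ h1, hsq _ _ h2, hsq _ _ h3, hsq _ _ h4]
  generalize d 1 = a at *
  generalize d 2 = b at *
  generalize d 3 = c at *
  generalize d 4 = e at *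
  have hE : x4 * e = (-1 - x1 * a - x2 * b - x3 * c) / 2 := by linarith
  have key : 0 < e * a * (x1 - x4) ^ 2 + e * b * (x2 - x4) ^ 2 + e * c * (x3 - x4) ^ 2 := by
    rcases hr with hr | hr | hr
    · have : 0 < e * a * (x1 - x4) ^ 2 := by
        have : x1 - x4 ≠ 0 := sub_ne_zero.2 hr
        positivity
      positivity
    · have : 0 < e * b * (x2 - x4) ^ 2 := by
        have : x2 - x4 ≠ 0 := sub_ne_zero.2 hr
        positivity
      positivity
    · have : 0 < e * c * (x3 - x4) ^ 2 := by
        have : x3 - x4 ≠ 0 := sub_ne_zero.2 hr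
        positivity
      positivity
  have hone : (x1 * a + x2 * b + x3 * c + 2 * (x4 * e)) ^ 2 = 1 := by
    have : x1 * a + x2 * b + x3 * c + 2 * (x4 * e) = -1 := by linarith
    rw [this]; norm_num
  have h12 : 0 ≤ a * b * (x1 - x2) ^ 2 := by positivity
  have h13 : 0 ≤ a * c * (x1 - x3) ^ 2 := by positivity
  have h23 : 0 ≤ b * c * (x2 - x3) ^ 2 := by positivity
  nlinarith

theorem mChi_eq_zero_of_ratio_eq (h0 : d 0 = 1) (hp0 : p 0 = 1) (h5 : d 5 = d 4) (hp5 : p 5 = p 4)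
    (hd : ∀ i, 0 < d i) (hsum : 1 + p 1 + p 2 + p 3 + 2 * p 4 = 0)
    (h1 : p 1 / d 1 = p 4 / d 4) (h2 : p 2 / d 2 = p 4 / d 4) (h3 : p 3 / d 3 = p 4 / d 4) :
    mChi d p = 0 := by
  obtain ⟨q, hq⟩ : ∃ q, q = p 4 / d 4 := ⟨_, rfl⟩
  have d1 := hd 1; have d2 := hd 2; have d3 := hd 3; have d4 := hd 4
  rw [← hq] at h1 h2 h3
  rw [div_eq_iff (hd _).ne'] at h1 h2 h3
  rw [eq_div_iff (hd _).ne'] at hq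
  have hS : ∑ i, p i ^ 2 / d i = 1 - q := by
    simp only [Fin.sum_univ_six, h0, hp0, h5, hp5]
    rw [h1, h2, h3, ← hq]
    rw [h1, h2, h3, ← hq] at hsum
    field_simp
    linear_combination q * hsum
  have hN : q * (order d - 1) = -1 := by
    rw [h1, h2, h3, ← hq] at hsum
    unfold order
    linear_combination hsum
  have hq1 : 0 < 1 - q := by
    have : 0 < order d - 1 := by unfold order; linarith
    nlinarith
  unfold mChi mPhi
  rw [hS]
  field_simp
  linear_combination -hN

end Parameters

section TableForm

variable {A : Type u} [Ring A] [Algebra ℂ A] [StarRing A] [StarModule ℂ A]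
  {b : Module.Basis (Fin 6) ℂ A} {δ : A →ₐ[ℂ] ℂ}

theorem IsRBABasis.exists_algEquiv_model (h : IsRBABasis b) (δ : A →ₐ[ℂ] ℂ)
    (hnc : ∃ x y : A, x * y ≠ y * x) : ∃ f : A ≃ₐ[ℂ] Model, ∀ a, (f a).1 = δ a := by
  have := h.isSemisimpleRing
  exact RBA.exists_algEquiv_model (by simp [Module.finrank_eq_card_basis b]) hnc δ

theorem IsNumberedBasis.exists_parameters (h : IsNumberedBasis b δ) {f : A ≃ₐ[ℂ] Model}
    (hf : ∀ a, (f a).1 = δ a) :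
    ∃ d p : Fin 6 → ℝ, Admissible d p ∧ (∀ k i, table d p k i = modelChar f k (b i)) ∧
      standardTrace b δ = ∑ k, mult d p k • modelChar f k := by
  have hs := h.isStandardRBABasis
  have hb := hs.isRBABasis
  have hδ := hs.isPositiveDegreeMap
  obtain ⟨α, hα0, hα⟩ := hb.exists_coord_eq_sum f
  obtain ⟨d, hd⟩ : ∃ d : Fin 6 → ℝ, ∀ i, (d i : ℂ) = δ (b i) :=
    ⟨fun i => (δ (b i)).re, fun i => Complex.conj_eq_iff_re.1 (hδ.conj_eq i)⟩
  obtain ⟨p, hp⟩ : ∃ p : Fin 6 → ℝ, ∀ i, (p i : ℂ) = modelChar f 1 (b i) :=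
    ⟨fun i => (modelChar f 1 (b i)).re,
      fun i => Complex.conj_eq_iff_re.1 (hb.conj_modelChar_one hδ hf i)⟩
  have hdpos : ∀ i, 0 < d i := fun i => by
    have := (hδ.pos i).2
    rwa [← hd, Complex.ofReal_re] at this
  have hd0 : d 0 = 1 := by
    have := hd 0
    rw [hb.zero_eq_one, map_one] at this
    exact_mod_cast this
  have hp0 : p 0 = 1 := by
    have := hp 0
    rw [hb.zero_eq_one, modelChar_apply_one] at this
    change (p 0 : ℂ) = 1 at this
    exact_mod_cast this
  have hψ1 : ∀ i, modelChar f 1 (star (b i)) = modelChar f 1 (b i) := fun i => by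
    rw [← transposeMap_basis, hb.modelChar_one_transposeMap hδ hf]
  have hψ0 : ∀ i, modelChar f 0 (star (b i)) = modelChar f 0 (b i) := fun i => by
    rw [modelChar_zero_eq hf]; exact hδ.star_eq i
  have hψ0' : ∀ i, modelChar f 0 (b i) = d i := fun i => by
    rw [modelChar_zero_eq hf, hd]; rfl
  have hd5 : d 5 = d 4 := by
    have := hδ.star_eq 4
    rw [h.star_four, ← hd, ← hd] at this
    exact_mod_cast this
  have hp5 : p 5 = p 4 := by
    have := hψ1 4
    rw [h.star_four, ← hp, ← hp] at this
    exact_mod_cast this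
  have hw : ∀ i, hb.weight i = d i := fun i => by
    have := hs.weight_eq i
    rw [← hd] at this
    exact_mod_cast this
  have hdne : ∀ i, (d i : ℂ) ≠ 0 := fun i => Complex.ofReal_ne_zero.2 (hdpos i).ne'
  have hn : ∑ i, δ (b i) = (order d : ℂ) := by
    simp only [← hd, Fin.sum_univ_six, hd0, hd5, order]
    push_cast
    ring
  have hnpos : 0 < order d := by
    have := hdpos 1; have := hdpos 2; have := hdpos 3; have := hdpos 4
    unfold order; positivity
  have hnne : (order d : ℂ) ≠ 0 := Complex.ofReal_ne_zero.2 hnpos.ne'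
  have h00 : α 0 * order d = 1 := by
    have := hb.sum_mul_div_weight hα 0 0
    simp only [hψ0, hψ0', hw, modelChar_apply_one] at this
    rw [← hn, Finset.mul_sum]
    refine Eq.trans (Finset.sum_congr rfl fun i _ => ?_) (this.trans (by simp))
    rw [← hd, mul_div_cancel_right₀ _ (hdne i)]
  have hsum : 1 + p 1 + p 2 + p 3 + 2 * p 4 = 0 := by
    have := hb.sum_mul_div_weight hα 0 1
    simp only [hψ0, hψ0', hw, ← hp] at this
    have e : α 0 * ∑ i, (p i : ℂ) = 0 := by
      rw [Finset.mul_sum]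
      refine Eq.trans (Finset.sum_congr rfl fun i _ => ?_) (this.trans (by simp))
      have := hdne i
      field_simp
    have e' := (mul_eq_zero.1 e).resolve_left (hα0 0)
    simp only [Fin.sum_univ_six, hp5, hp0] at e'
    have e2 : (1 : ℝ) + p 1 + p 2 + p 3 + p 4 + p 4 = 0 := by exact_mod_cast e'
    linarith
  have h11 : α 1 * ((∑ i, p i ^ 2 / d i : ℝ) : ℂ) = 1 := by
    have := hb.sum_mul_div_weight hα 1 1
    simp only [hψ1, hw, ← hp, modelChar_apply_one] at this
    rw [Complex.ofReal_sum, Finset.mul_sum]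
    refine Eq.trans (Finset.sum_congr rfl fun i _ => ?_) (this.trans (by simp))
    push_cast
    ring
  have hSne : ((∑ i, p i ^ 2 / d i : ℝ) : ℂ) ≠ 0 := fun h0 => by
    rw [h0, mul_zero] at h11
    exact zero_ne_one h11
  have hm1 : order d * α 1 = (mPhi d p : ℂ) := by
    unfold mPhi
    rw [Complex.ofReal_div, eq_div_iff hSne, mul_assoc, h11, mul_one]
  have hcoord : ∀ i, α 0 * d i + α 1 * p i + α 2 * modelChar f 2 (b i) = if i = 0 then 1 else 0 := by
    intro i
    have := LinearMap.congr_fun hα (b i)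
    simp only [Fin.sum_univ_three, LinearMap.add_apply, LinearMap.smul_apply, smul_eq_mul, hψ0',
      ← hp, Module.Basis.coord_apply, Module.Basis.repr_self, Finsupp.single_apply] at this
    exact this.symm
  have hm2 : order d * α 2 = (mChi d p : ℂ) := by
    have := hcoord 0
    rw [hd0, hp0, hb.zero_eq_one, modelChar_apply_one, if_pos rfl] at this
    unfold mChi
    push_cast
    simp only [Matrix.cons_val] at this
    rw [← hm1]
    push_cast at this
    linear_combination (order d / 2 : ℂ) * this - h00 / 2
  have hmC : (mChi d p : ℂ) ≠ 0 := by
    rw [← hm2]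
    exact mul_ne_zero hnne (hα0 2)
  have hadm : Admissible d p := by
    refine ⟨hd0, hp0, hd5, hp5, hdpos, hsum, ?_⟩
    by_contra! hr
    apply hmC
    rw [mChi_eq_zero_of_ratio_eq hd0 hp0 hd5 hp5 hdpos hsum hr.1 hr.2.1 hr.2.2]
    simp
  refine ⟨d, p, hadm, ?_, ?_⟩
  · intro k i
    fin_cases k
    · exact (hψ0' i).symm
    · exact hp i
    · change ((chiVal d p i : ℝ) : ℂ) = modelChar f 2 (b i)
      unfold chiVal
      split_ifs with hi
      · subst hi
        rw [hb.zero_eq_one, modelChar_apply_one]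
        simp
      · have := hcoord i
        rw [if_neg hi] at this
        push_cast
        rw [div_eq_iff hmC, ← hm1, ← hm2]
        linear_combination (d i : ℂ) * h00 - (order d : ℂ) * this
  · rw [standardTrace, hn, hα, Finset.smul_sum]
    refine Finset.sum_congr rfl fun k _ => ?_
    rw [smul_smul]
    congr 1
    fin_cases k
    · exact (mul_comm _ _).trans h00
    · exact hm1
    · exact hm2

theorem IsNumberedBasis.exists_table (h : IsNumberedBasis b δ)
    (hnc : ∃ x y : A, x * y ≠ y * x) :
    ∃ d p : Fin 6 → ℝ, Admissible d p ∧
      ∀ (T : Matrix (Fin 3) (Fin 6) ℂ) (m : Fin 3 → ℂ),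
        IsCharacterTable b δ T m ↔ T = table d p ∧ m = mult d p := by
  obtain ⟨f, hf⟩ := h.isStandardRBABasis.isRBABasis.exists_algEquiv_model δ hnc
  obtain ⟨d, p, hadm, htab, hτ⟩ := h.exists_parameters hf
  refine ⟨d, p, hadm, fun T m => ?_⟩
  rw [isCharacterTable_iff hf hτ]
  simp only [← htab]
  rw [← Matrix.ext_iff]

end TableForm

section Rescaling

variable {A : Type u} [Ring A] [Algebra ℂ A] [StarRing A] [StarModule ℂ A] {r : ℕ} [NeZero r]
  {b : Module.Basis (Fin r) ℂ A} {δ : A →ₐ[ℂ] ℂ}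

theorem IsRBABasis.exists_standard (h : IsRBABasis b) (hδ : IsPositiveDegreeMap b δ)
    (σ : Equiv.Perm (Fin r)) (hσ : σ 0 = 0) :
    ∃ c : Module.Basis (Fin r) ℂ A, IsRescaling b c ∧ IsStandardRBABasis c δ ∧
      ∀ i j, star (c i) = c j ↔ h.adj (σ i) = σ j := by
  obtain ⟨t, htdef⟩ : ∃ t : Fin r → ℝ, ∀ i, t i = (δ (b i)).re / h.weight i := ⟨_, fun _ => rfl⟩
  have ht : ∀ i, 0 < t i := fun i => by
    rw [htdef]; exact div_pos (hδ.pos i).2 (h.weight_pos i)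
  have htadj : ∀ i, t (h.adj i) = t i := fun i => by
    rw [htdef, htdef, h.weight_adj, ← h.star_eq, hδ.star_eq]
  have htw : ∀ i, (t i : ℂ) * h.weight i = δ (b i) := fun i => by
    rw [← Complex.ofReal_mul, htdef, div_mul_cancel₀ _ (h.weight_pos i).ne']
    exact Complex.conj_eq_iff_re.1 (hδ.conj_eq i)
  have ht0 : t 0 = 1 := by
    rw [htdef, h.weight_zero, h.zero_eq_one, map_one]; simp
  have htne : ∀ i, (t i : ℂ) ≠ 0 := fun i => Complex.ofReal_ne_zero.2 (ht i).ne'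
  let c : Module.Basis (Fin r) ℂ A := (b.reindex σ.symm).isUnitSMul
    (w := fun i => (t (σ i) : ℂ)) (fun i => (htne (σ i)).isUnit)
  have hc : ∀ i, c i = (t (σ i) : ℂ) • b (σ i) := fun i => by
    simp [c, Module.Basis.isUnitSMul_apply]
  have hrepr : ∀ x k, (t (σ k) : ℂ) * c.repr x k = b.repr x (σ k) := fun x k => by
    simp only [c, Module.Basis.repr_isUnitSMul, Module.Basis.repr_reindex_apply,
      Equiv.symm_symm, Units.smul_def, smul_eq_mul]
    have : (((htne (σ k)).isUnit.unit⁻¹ : ℂˣ) : ℂ) = (t (σ k) : ℂ)⁻¹ := by simp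
    rw [this, mul_inv_cancel_left₀ (htne _)]
  have hsc : ∀ i j k, structConst c i j k =
      ((t (σ i) * t (σ j) / t (σ k) : ℝ) : ℂ) * structConst b (σ i) (σ j) (σ k) := by
    intro i j k
    apply mul_left_cancel₀ (htne (σ k))
    unfold structConst
    rw [hrepr, hc, hc, smul_mul_smul_comm, map_smul, Finsupp.smul_apply, smul_eq_mul]
    push_cast
    have := htne (σ k)
    field_simp
  have hstar : ∀ i j, star (c i) = c j ↔ h.adj (σ i) = σ j := by
    intro i j
    have e : star (c i) = c (σ.symm (h.adj (σ i))) := by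
      rw [hc, hc, star_smul, h.star_eq, Equiv.apply_symm_apply, htadj]
      congr 1
      exact Complex.conj_ofReal _
    rw [e, c.injective.eq_iff, Equiv.symm_apply_eq]
  refine ⟨c, ⟨σ, fun i => t (σ i), fun i => ⟨ht _, hc i⟩⟩, ⟨⟨?_, ?_, ?_, ?_, ?_⟩, ⟨hδ.map_star, ?_⟩,
    ?_⟩, hstar⟩
  · rw [hc, hσ, ht0, h.zero_eq_one]; simp
  · intro i j k
    rw [hsc, Complex.im_ofReal_mul, h.real, mul_zero]
  · intro i
    exact ⟨σ.symm (h.adj (σ i)), (hstar _ _).2 (by simp)⟩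
  · intro i j
    rw [hstar, hsc, hσ, ht0, h.adj_eq_iff, ← h.ne_zero_iff, mul_ne_zero_iff]
    refine and_iff_right (Complex.ofReal_ne_zero.2 ?_)
    have := (ht (σ i)).ne'; have := (ht (σ j)).ne'
    positivity
  · intro i j hij
    rw [hstar] at hij
    rw [hsc, hsc, hσ, ht0, ← hij, htadj, h.structConst_adj,
      ← (h.symm_pos _ _ (h.star_eq (σ i))).1, h.structConst_adj, ← Complex.ofReal_mul]
    refine ⟨rfl, ?_⟩
    rw [Complex.ofReal_re]
    have := ht (σ i); have := h.weight_pos (σ i)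
    positivity
  · intro i
    rw [hc, map_smul, smul_eq_mul, Complex.im_ofReal_mul, Complex.re_ofReal_mul, (hδ.pos _).1]
    exact ⟨mul_zero _, mul_pos (ht _) (hδ.pos _).2⟩
  · intro i j hij
    rw [hstar] at hij
    rw [hsc, hσ, ht0, ← hij, htadj, h.structConst_adj, hc, map_smul, ← htw]
    push_cast
    simp only [smul_eq_mul]
    ring

omit [StarModule ℂ A] in
theorem IsRBABasis.repr_transposeMap (h : IsRBABasis b) (x : A) (k : Fin r) :
    b.repr (transposeMap b x) k = b.repr x (h.adj k) := by
  have key : b.coord k ∘ₗ transposeMap b = b.coord (h.adj k) := by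
    refine b.ext fun i => ?_
    rw [LinearMap.comp_apply, transposeMap_basis, h.star_eq]
    simp only [Module.Basis.coord_apply, Module.Basis.repr_self, Finsupp.single_apply]
    congr 1
    rw [eq_iff_iff]
    constructor <;> rintro rfl
    · exact (h.adj_adj i).symm
    · exact h.adj_adj k
  exact LinearMap.congr_fun key x

theorem IsRBABasis.exists_adj_ne (h : IsRBABasis b) (hnc : ∃ x y : A, x * y ≠ y * x) :
    ∃ i, h.adj i ≠ i := by
  by_contra! hall
  obtain ⟨x, y, hxy⟩ := hnc
  have hid : ∀ z, transposeMap b z = z := fun z => by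
    apply b.repr.injective
    ext k
    rw [h.repr_transposeMap, hall]
  apply hxy
  rw [← hid (x * y), h.transposeMap_mul, hid, hid]

end Rescaling

section Numbering

theorem exists_smul_add_smul_eq_zero_of_commute {X Y : Matrix (Fin 2) (Fin 2) ℂ}
    (hX : X.trace = 0) (hY : Y.trace = 0) (hXY : X * Y = Y * X) :
    ∃ s t : ℂ, (s ≠ 0 ∨ t ≠ 0) ∧ s • X + t • Y = 0 := by
  rw [Matrix.trace_fin_two] at hX hY
  have hX' : X 1 1 = -X 0 0 := by linear_combination hX
  have hY' : Y 1 1 = -Y 0 0 := by linear_combination hY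
  have e00 := congrFun (congrFun hXY 0) 0
  have e01 := congrFun (congrFun hXY 0) 1
  have e10 := congrFun (congrFun hXY 1) 0
  simp only [Matrix.mul_apply, Fin.sum_univ_two, hX', hY'] at e00 e01 e10
  have key : ∀ s t : ℂ, s * X 0 0 + t * Y 0 0 = 0 → s * X 0 1 + t * Y 0 1 = 0 →
      s * X 1 0 + t * Y 1 0 = 0 → s • X + t • Y = 0 := by
    intro s t h0 h1 h2
    ext i j
    fin_cases i <;> fin_cases j
    · simpa using h0
    · simpa using h1
    · simpa using h2
    · simp only [Matrix.add_apply, Matrix.smul_apply, smul_eq_mul, Fin.mk_one, hX', hY',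
        Matrix.zero_apply]
      linear_combination -h0
  by_cases ha : X 0 0 = 0
  · by_cases hb : X 0 1 = 0
    · by_cases hc : X 1 0 = 0
      · exact ⟨1, 0, Or.inl one_ne_zero, key _ _ (by simp [ha]) (by simp [hb]) (by simp [hc])⟩
      · refine ⟨Y 1 0, -X 1 0, Or.inr (neg_ne_zero.2 hc), key _ _ ?_ ?_ ?_⟩
        · linear_combination -e10 / 2
        · linear_combination e00
        · ring
    · refine ⟨Y 0 1, -X 0 1, Or.inr (neg_ne_zero.2 hb), key _ _ ?_ ?_ ?_⟩
      · linear_combination e01 / 2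
      · ring
      · linear_combination -e00
  · refine ⟨Y 0 0, -X 0 0, Or.inr (neg_ne_zero.2 ha), key _ _ ?_ ?_ ?_⟩
    · ring
    · linear_combination -e01 / 2
    · linear_combination e10 / 2

theorem exists_perm_fin_six {i j : Fin 6} (hi : i ≠ 0) (hj : j ≠ 0) (hij : i ≠ j) :
    ∃ σ : Equiv.Perm (Fin 6), σ 0 = 0 ∧ σ 4 = i ∧ σ 5 = j := by
  let τ : Equiv.Perm (Fin 6) := Equiv.swap 4 i
  have h4 : τ 4 = i := Equiv.swap_apply_left _ _
  have h0 : τ 0 = 0 := Equiv.swap_apply_of_ne_of_ne (by decide) hi.symm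
  have h50 : τ 5 ≠ 0 := by
    rw [← h0]; exact τ.injective.ne (by decide)
  have h54 : τ 5 ≠ i := by
    rw [← h4]; exact τ.injective.ne (by decide)
  refine ⟨Equiv.swap (τ 5) j * τ, ?_, ?_, ?_⟩
  · rw [Equiv.Perm.mul_apply, h0]
    exact Equiv.swap_apply_of_ne_of_ne h50.symm hj.symm
  · rw [Equiv.Perm.mul_apply, h4]
    exact Equiv.swap_apply_of_ne_of_ne h54.symm hij
  · rw [Equiv.Perm.mul_apply]
    exact Equiv.swap_apply_left _ _

variable {A : Type u} [Ring A] [Algebra ℂ A] [StarRing A] [StarModule ℂ A]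
  {b : Module.Basis (Fin 6) ℂ A} {δ : A →ₐ[ℂ] ℂ}

theorem IsRBABasis.model_fst_eq_zero_of_skew (h : IsRBABasis b) (hδ : IsPositiveDegreeMap b δ)
    {f : A ≃ₐ[ℂ] Model} (hf : ∀ a, (f a).1 = δ a) {i : Fin 6} (hi : h.adj i ≠ i) :
    ∃ X : Matrix (Fin 2) (Fin 2) ℂ, X.trace = 0 ∧ f (b i - b (h.adj i)) = (0, 0, X) := by
  have h0 : modelChar f 0 (b i - b (h.adj i)) = 0 := by
    rw [modelChar_zero_eq hf, map_sub, ← h.star_eq]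
    exact sub_eq_zero.2 (hδ.star_eq i).symm
  have h1 : modelChar f 1 (b i - b (h.adj i)) = 0 := by
    rw [map_sub, ← h.star_eq, ← transposeMap_basis, h.modelChar_one_transposeMap hδ hf, sub_self]
  obtain ⟨α, hα0, hα⟩ := h.exists_coord_eq_sum f
  have h2 : modelChar f 2 (b i - b (h.adj i)) = 0 := by
    have e : b.coord 0 (b i - b (h.adj i)) = 0 := by
      have hi0 : i ≠ 0 := fun h' => hi (by rw [h', h.adj_zero])
      have hi1 : h.adj i ≠ 0 := fun h' => hi0 (by rw [← h.adj_adj i, h', h.adj_zero])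
      simp [hi0, hi1]
    rw [hα] at e
    simp only [Fin.sum_univ_three, LinearMap.add_apply, LinearMap.smul_apply, h0, h1,
      smul_eq_mul, mul_zero, zero_add] at e
    exact (mul_eq_zero.1 e).resolve_left (hα0 2)
  exact ⟨(f (b i - b (h.adj i))).2.2, h2, Prod.ext h0 (Prod.ext h1 rfl)⟩

theorem IsRBABasis.commute_of_two_pairs (h : IsRBABasis b) {i j : Fin 6} (hi : h.adj i ≠ i)
    (hj : h.adj j ≠ j) (hij : j ≠ i) (hij' : j ≠ h.adj i) :
    (b i - b (h.adj i)) * (b j - b (h.adj j)) = (b j - b (h.adj j)) * (b i - b (h.adj i)) := by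
  have hi0 : i ≠ 0 := fun h' => hi (by rw [h', h.adj_zero])
  have hj0 : j ≠ 0 := fun h' => hj (by rw [h', h.adj_zero])
  have hne0 : ∀ k, k ≠ 0 → h.adj k ≠ 0 := fun k hk h' => hk (by rw [← h.adj_adj k, h', h.adj_zero])
  have hinj : ∀ k l, h.adj k = h.adj l → k = l := fun k l hkl => by
    rw [← h.adj_adj k, hkl, h.adj_adj]
  have hij'' : h.adj j ≠ i := fun h' => hij' (by rw [← h', h.adj_adj])
  have hij3 : h.adj j ≠ h.adj i := fun h' => hij (hinj _ _ h')
  have hcov : ∀ k, h.adj k = k ∨ k = i ∨ k = h.adj i ∨ k = j ∨ k = h.adj j := by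
    intro k
    by_contra! hk
    obtain ⟨hk, k1, k2, k3, k4⟩ := hk
    have hk0 : k ≠ 0 := fun h' => hk (by rw [h', h.adj_zero])
    have k1' : h.adj k ≠ h.adj i := fun h' => k1 (hinj _ _ h')
    have k3' : h.adj k ≠ h.adj j := fun h' => k3 (hinj _ _ h')
    have k2' : h.adj k ≠ i := fun h' => k2 (by rw [← h', h.adj_adj])
    have k4' : h.adj k ≠ j := fun h' => k4 (by rw [← h', h.adj_adj])
    have hnd : [0, i, h.adj i, j, h.adj j, k, h.adj k].Nodup := by
      simp only [List.nodup_cons, List.mem_cons, List.not_mem_nil, not_or, or_false,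
        List.nodup_nil, not_false_eq_true, and_true]
      exact ⟨⟨hi0.symm, (hne0 _ hi0).symm, hj0.symm, (hne0 _ hj0).symm, hk0.symm,
        (hne0 _ hk0).symm⟩, ⟨hi.symm, hij.symm, hij''.symm, k1.symm, k2'.symm⟩,
        ⟨hij'.symm, hij3.symm, k2.symm, k1'.symm⟩, ⟨hj.symm, k3.symm, k4'.symm⟩,
        ⟨k4.symm, k3'.symm⟩, hk.symm⟩
    have := hnd.length_le_card
    simp at this
  obtain ⟨x, hx⟩ : ∃ x, x = b i - b (h.adj i) := ⟨_, rfl⟩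
  obtain ⟨y, hy⟩ : ∃ y, y = b j - b (h.adj j) := ⟨_, rfl⟩
  rw [← hx, ← hy]
  have hskew : ∀ k, transposeMap b (b k - b (h.adj k)) = -(b k - b (h.adj k)) := fun k => by
    rw [map_sub, transposeMap_basis, transposeMap_basis, h.star_eq, h.star_eq, h.adj_adj, neg_sub]
  have hxs : transposeMap b x = -x := by rw [hx, hskew]
  have hys : transposeMap b y = -y := by rw [hy, hskew]
  obtain ⟨z, hz⟩ : ∃ z, z = x * y - y * x := ⟨_, rfl⟩
  have hzs : transposeMap b z = -z := by
    rw [hz, map_sub, h.transposeMap_mul, h.transposeMap_mul, hxs, hys]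
    noncomm_ring
  have hzk : ∀ k, b.repr z (h.adj k) = -b.repr z k := fun k => by
    rw [← h.repr_transposeMap, hzs, map_neg, Finsupp.neg_apply]
  have hzxy : z = b.repr z i • x + b.repr z j • y := by
    apply b.repr.injective
    ext k
    simp only [hx, hy, map_add, map_smul, map_sub, Module.Basis.repr_self, Finsupp.add_apply,
      Finsupp.smul_apply, Finsupp.sub_apply, Finsupp.single_apply, smul_eq_mul]
    rcases hcov k with hk | rfl | rfl | rfl | rfl
    · have e := hzk k
      rw [hk] at e
      have e0 : b.repr z k = 0 := self_eq_neg.1 e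
      have k1 : i ≠ k := fun h' => hi (by rw [h', hk])
      have k2 : h.adj i ≠ k := fun h' => k1 (hinj _ _ (by rw [h', hk]))
      have k3 : j ≠ k := fun h' => hj (by rw [h', hk])
      have k4 : h.adj j ≠ k := fun h' => k3 (hinj _ _ (by rw [h', hk]))
      simp [e0, k1, k2, k3, k4]
    · simp [hi, hij, hij'']
    · simp [hi.symm, hij', hij3, hzk]
    · simp [hj, hij.symm, hij'.symm]
    · simp [hj.symm, hij''.symm, hij3.symm, hzk]
  have hc := h.coord_mul_comm
  have tzx : b.coord 0 (z * x) = 0 := by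
    rw [hz, sub_mul, map_sub, hc (y * x) x, mul_assoc, sub_self]
  have tzy : b.coord 0 (z * y) = 0 := by
    rw [hz, sub_mul, map_sub, hc (x * y) y, mul_assoc, sub_self]
  have hself : ∀ k, h.adj k ≠ k → b.coord 0 ((b k - b (h.adj k)) * (b k - b (h.adj k)))
      = -2 * (h.weight k : ℂ) := by
    intro k hk
    simp only [sub_mul, mul_sub, map_sub, h.coord_mul_basis, h.adj_adj, h.weight_adj]
    simp [hk, hk.symm]
    ring
  have hyx : b.coord 0 (y * x) = 0 := by
    rw [hx, hy]
    simp only [sub_mul, mul_sub, map_sub, h.coord_mul_basis, h.adj_adj]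
    simp [hij.symm, hij'.symm, hij''.symm, hij3.symm]
  have hxy : b.coord 0 (x * y) = 0 := by rw [hc, hyx]
  have hw : ∀ k, -2 * (h.weight k : ℂ) ≠ 0 := fun k =>
    mul_ne_zero (by norm_num) (Complex.ofReal_ne_zero.2 (h.weight_pos k).ne')
  have hzi : b.repr z i = 0 := by
    rw [hzxy, add_mul, smul_mul_assoc, smul_mul_assoc, map_add, map_smul, map_smul, hyx, smul_zero,
      add_zero, hx, hself i hi, smul_eq_mul] at tzx
    exact (mul_eq_zero.1 tzx).resolve_right (hw i)
  have hzj : b.repr z j = 0 := by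
    rw [hzxy, add_mul, smul_mul_assoc, smul_mul_assoc, map_add, map_smul, map_smul, hxy, smul_zero,
      zero_add, hy, hself j hj, smul_eq_mul] at tzy
    exact (mul_eq_zero.1 tzy).resolve_right (hw j)
  rw [hzi, hzj, zero_smul, zero_smul, add_zero] at hzxy
  exact sub_eq_zero.1 (hz.symm.trans hzxy)

theorem IsRBABasis.adj_eq_self (h : IsRBABasis b) (hδ : IsPositiveDegreeMap b δ)
    (hnc : ∃ x y : A, x * y ≠ y * x) {i j : Fin 6} (hi : h.adj i ≠ i) (hij : j ≠ i)
    (hij' : j ≠ h.adj i) : h.adj j = j := by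
  by_contra hj
  obtain ⟨f, hf⟩ := h.exists_algEquiv_model δ hnc
  obtain ⟨X, hX, hfX⟩ := h.model_fst_eq_zero_of_skew hδ hf hi
  obtain ⟨Y, hY, hfY⟩ := h.model_fst_eq_zero_of_skew hδ hf hj
  have hcomm := congrArg f (h.commute_of_two_pairs hi hj hij hij')
  rw [map_mul, map_mul, hfX, hfY] at hcomm
  have hXY : X * Y = Y * X := congrArg (fun z : Model => z.2.2) hcomm
  obtain ⟨s, t, hst, h0⟩ := exists_smul_add_smul_eq_zero_of_commute hX hY hXY
  have hlin : s • (b i - b (h.adj i)) + t • (b j - b (h.adj j)) = 0 := by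
    apply f.injective
    rw [map_add, map_smul, map_smul, hfX, hfY, map_zero]
    exact Prod.ext (by simp) (Prod.ext (by simp) (by simpa using h0))
  have hij'' : h.adj j ≠ i := fun h' => hij' (by rw [← h', h.adj_adj])
  have hs : s = 0 := by
    have := congrArg (fun z => b.repr z i) hlin
    simpa [hi, hij, hij''] using this
  have ht : t = 0 := by
    have := congrArg (fun z => b.repr z j) hlin
    simpa [hj, hij.symm, hij'.symm] using this
  exact hst.elim (fun h => h hs) fun h => h ht

theorem IsRBABasis.exists_numbering (h : IsRBABasis b) (hδ : IsPositiveDegreeMap b δ)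
    (hnc : ∃ x y : A, x * y ≠ y * x) :
    ∃ c : Module.Basis (Fin 6) ℂ A, IsRescaling b c ∧ IsNumberedBasis c δ := by
  obtain ⟨i, hi⟩ := h.exists_adj_ne hnc
  have hi0 : i ≠ 0 := fun h' => hi (by rw [h', h.adj_zero])
  have hi1 : h.adj i ≠ 0 := fun h' => hi0 (by rw [← h.adj_adj i, h', h.adj_zero])
  obtain ⟨σ, h0, h4, h5⟩ := exists_perm_fin_six hi0 hi1 hi.symm
  obtain ⟨c, hbc, hc, hstar⟩ := h.exists_standard hδ σ h0
  have hfix : ∀ k : Fin 6, k ≠ 4 → k ≠ 5 → star (c k) = c k := fun k hk4 hk5 =>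
    (hstar k k).2 (h.adj_eq_self hδ hnc hi (by rw [← h4]; exact σ.injective.ne hk4)
      (by rw [← h5]; exact σ.injective.ne hk5))
  exact ⟨c, hbc, hc, hfix 1 (by decide) (by decide), hfix 2 (by decide) (by decide),
    hfix 3 (by decide) (by decide), (hstar 4 5).2 (by rw [h4, h5])⟩

end Numbering

section TraceIdentities

/-- The alternating trilinear form `tr (XYZ) - tr (XZY)`. -/
def alternatingTrace (X Y Z : Matrix (Fin 2) (Fin 2) ℂ) : ℂ :=
  (X * Y * Z).trace - (X * Z * Y).trace

/-- The trace form of the traceless parts. -/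
noncomputable def tracelessForm (X Y : Matrix (Fin 2) (Fin 2) ℂ) : ℂ :=
  (X * Y).trace - X.trace * Y.trace / 2

theorem trace_mul_mul_add (X Y Z : Matrix (Fin 2) (Fin 2) ℂ) :
    2 * (X * Y * Z).trace = X.trace * (Y * Z).trace + Y.trace * (X * Z).trace
      + Z.trace * (X * Y).trace - X.trace * Y.trace * Z.trace + alternatingTrace X Y Z := by
  simp only [alternatingTrace, Matrix.trace_fin_two, Matrix.mul_apply, Fin.sum_univ_two]
  ring

theorem trace_mul_mul_reverse (X Y Z : Matrix (Fin 2) (Fin 2) ℂ) :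
    (Z * Y * X).trace = (X * Y * Z).trace - alternatingTrace X Y Z := by
  simp only [alternatingTrace, Matrix.trace_fin_two, Matrix.mul_apply, Fin.sum_univ_two]
  ring

/-- The traceless part of a matrix of size two in the basis `e, f, h` of `sl₂`. -/
noncomputable def tracelessCoord (X : Matrix (Fin 2) (Fin 2) ℂ) : Fin 3 → ℂ :=
  ![X 0 1, X 1 0, (X 0 0 - X 1 1) / 2]

theorem alternatingTrace_eq_det (X : Fin 3 → Matrix (Fin 2) (Fin 2) ℂ) :
    alternatingTrace (X 0) (X 1) (X 2) =
      2 * (Matrix.of fun i => tracelessCoord (X i)).det := by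
  simp only [alternatingTrace, Matrix.trace_fin_two, Matrix.mul_apply, Fin.sum_univ_two,
    Matrix.det_fin_three, Matrix.of_apply, tracelessCoord, Matrix.cons_val]
  ring

theorem tracelessForm_eq (X Y : Fin 3 → Matrix (Fin 2) (Fin 2) ℂ) :
    (Matrix.of fun i j => tracelessForm (X i) (Y j)) =
      (Matrix.of fun i => tracelessCoord (X i)) * !![0, 1, 0; 1, 0, 0; 0, 0, 2] *
        (Matrix.of fun i => tracelessCoord (Y i)).transpose := by
  ext i j
  simp only [tracelessForm, tracelessCoord, Matrix.trace_fin_two, Matrix.mul_apply,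
    Fin.sum_univ_two, Fin.sum_univ_three, Matrix.of_apply, Matrix.transpose_apply,
    Matrix.cons_val]
  ring

theorem alternatingTrace_mul (X Y : Fin 3 → Matrix (Fin 2) (Fin 2) ℂ) :
    alternatingTrace (X 0) (X 1) (X 2) * alternatingTrace (Y 0) (Y 1) (Y 2) =
      -2 * (Matrix.of fun i j => tracelessForm (X i) (Y j)).det := by
  have : (!![0, 1, 0; 1, 0, 0; 0, 0, 2] : Matrix (Fin 3) (Fin 3) ℂ).det = -2 := by
    simp [Matrix.det_fin_three]
  rw [tracelessForm_eq, Matrix.det_mul, Matrix.det_mul, this, Matrix.det_transpose,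
    alternatingTrace_eq_det, alternatingTrace_eq_det]
  ring

theorem eq_or_eq_neg_of_mul_eq {ι : Type*} {F G : ι → ℂ} (h : ∀ a b, F a * F b = G a * G b) :
    F = G ∨ F = -G := by
  by_cases hF : ∀ a, F a = 0
  · left
    funext a
    rw [hF a]
    have := h a a
    rw [hF a, zero_mul] at this
    exact (mul_self_eq_zero.1 this.symm).symm
  · push Not at hF
    obtain ⟨a, ha⟩ := hF
    rcases mul_self_eq_mul_self_iff.1 (h a a) with h' | h'
    · left
      funext b
      have := h a b
      rw [← h'] at this
      exact mul_left_cancel₀ ha this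
    · right
      funext b
      have := h a b
      rw [← neg_eq_iff_eq_neg.2 h', neg_mul, ← mul_neg] at this
      exact mul_left_cancel₀ ha this

end TraceIdentities

section Isomorphism

theorem modelChar_mul_eq {A : Type u} [Ring A] [Algebra ℂ A] {f : A ≃ₐ[ℂ] Model} {k : Fin 3} (hk : k ≠ 2) (x y : A) :
    modelChar f k (x * y) = modelChar f k x * modelChar f k y := by
  fin_cases k
  · simp [modelChar_zero]
  · simp [modelChar_one]
  · exact absurd rfl hk

variable {A : Type u} [Ring A] [Algebra ℂ A] [StarRing A] [StarModule ℂ A]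
  {C : Type v} [Ring C] [Algebra ℂ C] [StarRing C] [StarModule ℂ C]

omit [StarModule ℂ A] [StarModule ℂ C] in
theorem exactlyIsomorphic_of_coord_mul_mul {r : ℕ} [NeZero r]
    {b : Module.Basis (Fin r) ℂ A} {c : Module.Basis (Fin r) ℂ C}
    (hb : IsRBABasis b) (hc : IsRBABasis c) (π : Equiv.Perm (Fin r))
    (hπ : ∀ k, hc.adj (π k) = π (hb.adj k)) (hw : ∀ k, hc.weight (π k) = hb.weight k)
    (ht : ∀ i j k, c.coord 0 (c (π i) * c (π j) * c (π k)) = b.coord 0 (b i * b j * b k)) :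
    ExactlyIsomorphic b c := by
  have hsc : ∀ i j k, structConst c (π i) (π j) (π k) = structConst b i j k := by
    intro i j k
    have e1 := hb.coord_mul_adj (b i * b j) k
    have e2 := hc.coord_mul_adj (c (π i) * c (π j)) (π k)
    rw [hπ, ht, e1, hw] at e2
    exact (mul_right_cancel₀ (Complex.ofReal_ne_zero.2 (hb.weight_pos k).ne') e2).symm
  let e : A ≃ₗ[ℂ] C := b.equiv c π
  have he : ∀ i, e (b i) = c (π i) := fun i => b.equiv_apply i c π
  have hmul : ∀ x y, e (x * y) = e x * e y := by
    have key : (LinearMap.mul ℂ A).compr₂ e.toLinearMap =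
        (LinearMap.mul ℂ C).compl₁₂ e.toLinearMap e.toLinearMap := by
      refine b.ext fun i => b.ext fun j => ?_
      simp only [LinearMap.compr₂_apply, LinearMap.compl₁₂_apply, LinearMap.mul_apply',
        LinearEquiv.coe_coe, he]
      rw [basis_mul_basis, basis_mul_basis, map_sum,
        ← Equiv.sum_comp π fun k => structConst c (π i) (π j) k • c k]
      refine Finset.sum_congr rfl fun k _ => ?_
      rw [map_smul, he, hsc]
    intro x y
    exact congrArg (fun f => f x y) key
  have hone : e 1 = 1 := by
    have h1 : ∀ y, e 1 * y = y := fun y => by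
      rw [← e.apply_symm_apply y, ← hmul, one_mul]
    simpa using h1 1
  exact ⟨π, AlgEquiv.ofLinearEquiv e hone hmul, he⟩

omit [StarModule ℂ A] in
theorem IsNumberedBasis.adj_eq {b : Module.Basis (Fin 6) ℂ A} {δ : A →ₐ[ℂ] ℂ}
    (h : IsNumberedBasis b δ) (hb : IsRBABasis b) (i : Fin 6) :
    hb.adj i = Equiv.swap 4 5 i := by
  rw [hb.adj_eq_iff]
  have h5 : star (b 5) = b 4 := by rw [← h.star_four, star_star]
  fin_cases i
  · exact (by rw [hb.zero_eq_one, _root_.star_one] : star (b 0) = b 0)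
  · exact h.star_one
  · exact h.star_two
  · exact h.star_three
  · exact h.star_four
  · exact h5

theorem IsRBABasis.modelChar_transposeMap {r : ℕ} [NeZero r] {b : Module.Basis (Fin r) ℂ A}
    {δ : A →ₐ[ℂ] ℂ} (h : IsRBABasis b) (hδ : IsPositiveDegreeMap b δ) {f : A ≃ₐ[ℂ] Model}
    (hf : ∀ a, (f a).1 = δ a) (k : Fin 3) (x : A) :
    modelChar f k (transposeMap b x) = modelChar f k x := by
  have h0 : ∀ x, modelChar f 0 (transposeMap b x) = modelChar f 0 x := by
    have key : δ.toLinearMap ∘ₗ transposeMap b = δ.toLinearMap := b.ext fun i => by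
      rw [LinearMap.comp_apply, transposeMap_basis]
      exact hδ.star_eq i
    rw [modelChar_zero_eq hf]
    exact LinearMap.congr_fun key
  have h1 := h.modelChar_one_transposeMap hδ hf
  fin_cases k
  · exact h0 x
  · exact h1 x
  · obtain ⟨α, hα0, hα⟩ := h.exists_coord_eq_sum f
    have e := h.coord_transposeMap x
    rw [hα] at e
    simp only [Fin.sum_univ_three, LinearMap.add_apply, LinearMap.smul_apply, smul_eq_mul, h0,
      h1] at e
    exact mul_left_cancel₀ (hα0 2) (add_left_cancel e)

theorem exactlyIsomorphic_of_isCharacterTable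
    {b : Module.Basis (Fin 6) ℂ A} {δ : A →ₐ[ℂ] ℂ} {c : Module.Basis (Fin 6) ℂ C}
    {ε : C →ₐ[ℂ] ℂ} {T : Matrix (Fin 3) (Fin 6) ℂ} {m : Fin 3 → ℂ}
    (hncA : ∃ x y : A, x * y ≠ y * x) (hncC : ∃ x y : C, x * y ≠ y * x)
    (hnb : IsNumberedBasis b δ) (hnc : IsNumberedBasis c ε)
    (hTb : IsCharacterTable b δ T m) (hTc : IsCharacterTable c ε T m) :
    ExactlyIsomorphic b c := by
  have hb := hnb.isStandardRBABasis.isRBABasis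
  have hc := hnc.isStandardRBABasis.isRBABasis
  have hδ := hnb.isStandardRBABasis.isPositiveDegreeMap
  have hε := hnc.isStandardRBABasis.isPositiveDegreeMap
  obtain ⟨f, hf⟩ := hb.exists_algEquiv_model δ hncA
  obtain ⟨g, hg⟩ := hc.exists_algEquiv_model ε hncC
  obtain ⟨d, p, hadm, -, hτb⟩ := hnb.exists_parameters hf
  obtain ⟨d', p', -, -, hτc⟩ := hnc.exists_parameters hg
  obtain ⟨hTf, hm⟩ := (isCharacterTable_iff hf hτb T m).1 hTb
  obtain ⟨hTg, hm'⟩ := (isCharacterTable_iff hg hτc T m).1 hTc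
  have hm2 : m 2 ≠ 0 := by
    rw [hm]
    exact Complex.ofReal_ne_zero.2 hadm.mChi_pos.ne'
  rw [← hm] at hτb
  rw [← hm'] at hτc
  have hδT : ∀ i, δ (b i) = T 0 i := fun i => by
    rw [hTf, modelChar_zero_eq hf]; rfl
  have hεT : ∀ i, ε (c i) = T 0 i := fun i => by
    rw [hTg, modelChar_zero_eq hg]; rfl
  obtain ⟨n, hn⟩ : ∃ n, n = ∑ i, T 0 i := ⟨_, rfl⟩
  have hn0 : n ≠ 0 := by
    intro h0
    have : (∑ i, δ (b i)).re = 0 := by simp only [hδT, ← hn, h0, Complex.zero_re]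
    rw [Complex.re_sum] at this
    exact (Finset.sum_pos (fun i _ => (hδ.pos i).2) Finset.univ_nonempty).ne' this
  have htb : ∀ x, n * b.coord 0 x = m 0 * modelChar f 0 x + m 1 * modelChar f 1 x
      + m 2 * modelChar f 2 x := fun x => by
    have := LinearMap.congr_fun hτb x
    simpa only [standardTrace, hδT, ← hn, LinearMap.smul_apply, Fin.sum_univ_three,
      LinearMap.add_apply, smul_eq_mul] using this
  have htc : ∀ x, n * c.coord 0 x = m 0 * modelChar g 0 x + m 1 * modelChar g 1 x
      + m 2 * modelChar g 2 x := fun x => by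
    have := LinearMap.congr_fun hτc x
    simpa only [standardTrace, hεT, ← hn, LinearMap.smul_apply, Fin.sum_univ_three,
      LinearMap.add_apply, smul_eq_mul] using this
  have hwT : ∀ i, (hb.weight i : ℂ) = T 0 i := fun i => by
    rw [← hδT]; exact hnb.isStandardRBABasis.weight_eq i
  have hwT' : ∀ i, (hc.weight i : ℂ) = T 0 i := fun i => by
    rw [← hεT]; exact hnc.isStandardRBABasis.weight_eq i
  have hw : ∀ i, hc.weight i = hb.weight i := fun i => by
    exact_mod_cast (hwT' i).trans (hwT i).symm
  have hadj : ∀ i, hc.adj i = hb.adj i := fun i => by rw [hnc.adj_eq, hnb.adj_eq]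
  have hpair : ∀ i j, modelChar f 2 (b i * b j) = modelChar g 2 (c i * c j) := by
    intro i j
    have e1 := htb (b i * b j)
    have e2 := htc (c i * c j)
    rw [hb.coord_mul_basis, modelChar_mul_eq (by decide), modelChar_mul_eq (by decide),
      ← hTf, ← hTf, ← hTf, ← hTf] at e1
    rw [hc.coord_mul_basis, modelChar_mul_eq (by decide), modelChar_mul_eq (by decide),
      ← hTg, ← hTg, ← hTg, ← hTg, hadj, hw, e1] at e2
    exact mul_left_cancel₀ hm2 (add_left_cancel e2)
  obtain ⟨X, hX⟩ : ∃ X : Fin 6 → Matrix (Fin 2) (Fin 2) ℂ, ∀ i, X i = (f (b i)).2.2 :=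
    ⟨_, fun _ => rfl⟩
  obtain ⟨Y, hY⟩ : ∃ Y : Fin 6 → Matrix (Fin 2) (Fin 2) ℂ, ∀ i, Y i = (g (c i)).2.2 :=
    ⟨_, fun _ => rfl⟩
  have h1 : ∀ i, (X i).trace = (Y i).trace := fun i => by
    rw [hX, hY, ← modelChar_two, ← modelChar_two, ← hTf, ← hTg]
  have h2 : ∀ i j, (X i * X j).trace = (Y i * Y j).trace := fun i j => by
    have := hpair i j
    rwa [modelChar_two, modelChar_two, map_mul, map_mul, Prod.snd_mul, Prod.snd_mul, Prod.snd_mul,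
      Prod.snd_mul, ← hX, ← hX, ← hY, ← hY] at this
  have h3X : ∀ i j k, modelChar f 2 (b i * b j * b k) = (X i * X j * X k).trace := fun i j k => by
    rw [modelChar_two, map_mul, map_mul, Prod.snd_mul, Prod.snd_mul, Prod.snd_mul, Prod.snd_mul,
      ← hX, ← hX, ← hX]
  have h3Y : ∀ i j k, modelChar g 2 (c i * c j * c k) = (Y i * Y j * Y k).trace := fun i j k => by
    rw [modelChar_two, map_mul, map_mul, Prod.snd_mul, Prod.snd_mul, Prod.snd_mul, Prod.snd_mul,
      ← hY, ← hY, ← hY]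
  have hsign := eq_or_eq_neg_of_mul_eq
    (F := fun i : Fin 3 → Fin 6 => alternatingTrace (X (i 0)) (X (i 1)) (X (i 2)))
    (G := fun i : Fin 3 → Fin 6 => alternatingTrace (Y (i 0)) (Y (i 1)) (Y (i 2))) (by
      intro i j
      have e1 := alternatingTrace_mul (fun k => X (i k)) (fun k => X (j k))
      have e2 := alternatingTrace_mul (fun k => Y (i k)) (fun k => Y (j k))
      simp only [tracelessForm, h1, h2] at e1 e2
      exact e1.trans e2.symm)
  have hfinish : ∀ π : Equiv.Perm (Fin 6), (∀ k, hc.adj (π k) = π (hb.adj k)) →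
      (∀ k i, T k (π i) = T k i) →
      (∀ i j k, modelChar g 2 (c (π i) * c (π j) * c (π k)) =
        modelChar f 2 (b i * b j * b k)) → ExactlyIsomorphic b c := by
    intro π hπ hπT hπ3
    refine exactlyIsomorphic_of_coord_mul_mul hb hc π hπ (fun k => ?_) (fun i j k => ?_)
    · have := hwT' (π k)
      rw [hπT, ← hwT] at this
      exact_mod_cast this
    · apply mul_left_cancel₀ hn0
      rw [htb, htc, hπ3]
      simp only [modelChar_mul_eq (show (0 : Fin 3) ≠ 2 by decide),
        modelChar_mul_eq (show (1 : Fin 3) ≠ 2 by decide), ← hTf, ← hTg, hπT]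
  rcases hsign with hs | hs
  · refine hfinish (Equiv.refl _) hadj (fun _ _ => rfl) fun i j k => ?_
    have hs' : alternatingTrace (X i) (X j) (X k) = alternatingTrace (Y i) (Y j) (Y k) :=
      congrFun hs ![i, j, k]
    have e1 := trace_mul_mul_add (X i) (X j) (X k)
    have e2 := trace_mul_mul_add (Y i) (Y j) (Y k)
    simp only [Equiv.refl_apply]
    rw [h3X, h3Y]
    simp only [h1, h2, hs'] at e1
    exact mul_left_cancel₀ two_ne_zero (e2.trans e1.symm)
  · have hc5 : ∀ i, c (Equiv.swap 4 5 i) = transposeMap c (c i) := fun i => by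
      rw [transposeMap_basis, hc.star_eq, hnc.adj_eq]
    refine hfinish (Equiv.swap 4 5) (fun k => ?_) (fun k i => ?_) fun i j k => ?_
    · rw [hnc.adj_eq, hnb.adj_eq]
    · rw [hTg, hTg, hc5, hc.modelChar_transposeMap hε hg]
    have hs' : alternatingTrace (X i) (X j) (X k) = -alternatingTrace (Y i) (Y j) (Y k) :=
      congrFun hs ![i, j, k]
    have e1 := trace_mul_mul_add (X i) (X j) (X k)
    have e2 := trace_mul_mul_add (Y i) (Y j) (Y k)
    have e3 := trace_mul_mul_reverse (Y i) (Y j) (Y k)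
    rw [hc5, hc5, hc5, ← hc.transposeMap_mul, ← hc.transposeMap_mul,
      hc.modelChar_transposeMap hε hg, ← mul_assoc, h3X, h3Y]
    simp only [h1, h2, hs'] at e1
    linear_combination e3 + (e2 - e1) / 2

end Isomorphism

section Coordinates

theorem exists_weighted_orthogonal_extension {r : ℕ} {d N : Fin r → ℝ} (hd : ∀ i, 0 < d i)
    (hN : ∀ k, 0 < N k) (y : Fin r → Fin r → ℝ) (s : Set (Fin r))
    (hy : ∀ k ∈ s, ∀ l ∈ s, ∑ i, y k i * y l i / d i = if k = l then N k else 0) :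
    ∃ Y : Fin r → Fin r → ℝ, (∀ k ∈ s, Y k = y k) ∧
      (∀ k l, ∑ i, Y k i * Y l i / d i = if k = l then N k else 0) ∧
      ∀ i j, ∑ k, Y k i * Y k j / N k = if i = j then d i else 0 := by
  have hsd : ∀ i, √(d i) * √(d i) = d i := fun i => Real.mul_self_sqrt (hd i).le
  have hsN : ∀ i, √(N i) * √(N i) = N i := fun i => Real.mul_self_sqrt (hN i).le
  have hsd0 : ∀ i, √(d i) ≠ 0 := fun i => (Real.sqrt_pos.2 (hd i)).ne'
  have hsN0 : ∀ i, √(N i) ≠ 0 := fun i => (Real.sqrt_pos.2 (hN i)).ne'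
  let v : Fin r → EuclideanSpace ℝ (Fin r) := fun k =>
    WithLp.toLp 2 fun i => y k i / (√(N k) * √(d i))
  have hv : Orthonormal ℝ (s.domRestrict v) := by
    rw [orthonormal_iff_ite]
    rintro ⟨k, hk⟩ ⟨l, hl⟩
    have e : inner ℝ (v k) (v l) = (∑ i, y k i * y l i / d i) / (√(N k) * √(N l)) := by
      rw [PiLp.inner_apply, Finset.sum_div]
      refine Finset.sum_congr rfl fun i _ => ?_
      have h1 := hsN0 k; have h2 := hsN0 l; have h3 := hsd0 i
      simp only [v, RCLike.inner_apply, conj_trivial]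
      have e := hsd i
      generalize √(d i) = a at h3 e
      rw [← e]
      field_simp
    change inner ℝ (v k) (v l) = _
    rw [e, hy k hk l hl]
    by_cases hkl : k = l
    · subst hkl
      rw [if_pos rfl, if_pos rfl, hsN, div_self (hN k).ne']
    · rw [if_neg hkl, if_neg (by simpa using hkl), zero_div]
  obtain ⟨u, hu⟩ := hv.exists_orthonormalBasis_extension_of_card_eq (by simp)
  let U : Matrix (Fin r) (Fin r) ℝ := Matrix.of fun k i => u k i
  have hU : U * U.transpose = 1 := by
    ext k l
    have := orthonormal_iff_ite.1 u.orthonormal l k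
    rw [PiLp.inner_apply] at this
    simp only [RCLike.inner_apply, conj_trivial] at this
    rw [Matrix.mul_apply, Matrix.one_apply]
    simp only [U, Matrix.transpose_apply, Matrix.of_apply]
    rw [this]
    simp only [eq_comm]
  have hU' : U.transpose * U = 1 := mul_eq_one_comm.1 hU
  refine ⟨fun k i => U k i * (√(N k) * √(d i)), fun k hk => ?_, fun k l => ?_, fun i j => ?_⟩
  · funext i
    simp only [U, Matrix.of_apply, hu k hk, v]
    exact div_mul_cancel₀ _ (mul_ne_zero (hsN0 k) (hsd0 i))
  · have e := congrFun (congrFun hU k) l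
    rw [Matrix.mul_apply, Matrix.one_apply] at e
    have : ∑ i, U k i * (√(N k) * √(d i)) * (U l i * (√(N l) * √(d i))) / d i =
        √(N k) * √(N l) * ∑ i, U k i * U.transpose i l := by
      rw [Finset.mul_sum]
      refine Finset.sum_congr rfl fun i _ => ?_
      rw [div_eq_iff (hd i).ne', Matrix.transpose_apply]
      linear_combination (√(N k) * √(N l) * U k i * U l i) * hsd i
    rw [this, e]
    by_cases hkl : k = l
    · subst hkl
      rw [if_pos rfl, if_pos rfl, hsN, mul_one]
    · rw [if_neg hkl, if_neg hkl, mul_zero]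
  · have e := congrFun (congrFun hU' i) j
    rw [Matrix.mul_apply, Matrix.one_apply] at e
    have : ∑ k, U k i * (√(N k) * √(d i)) * (U k j * (√(N k) * √(d j))) / N k =
        √(d i) * √(d j) * ∑ k, U.transpose i k * U k j := by
      rw [Finset.mul_sum]
      refine Finset.sum_congr rfl fun k _ => ?_
      rw [div_eq_iff (hN k).ne', Matrix.transpose_apply]
      linear_combination (√(d i) * √(d j) * U k i * U k j) * hsN k
    rw [this, e]
    by_cases hij : i = j
    · subst hij
      rw [if_pos rfl, if_pos rfl, hsd, mul_one]
    · rw [if_neg hij, if_neg hij, mul_zero]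

variable {d p : Fin 6 → ℝ}

theorem Admissible.sum_d (h : Admissible d p) : ∑ i, d i = order d := by
  simp only [Fin.sum_univ_six, h.d_zero, h.d_five, order]
  ring

theorem Admissible.sum_p_eq_zero (h : Admissible d p) : ∑ i, p i = 0 := by
  simp only [Fin.sum_univ_six, h.p_zero, h.p_five]
  linear_combination h.sum_p

theorem Admissible.mPhi_mul_sum (h : Admissible d p) :
    mPhi d p * ∑ i, p i ^ 2 / d i = order d :=
  div_mul_cancel₀ _ h.sum_div_pos.ne'

theorem Admissible.mChi_mul_chiVal (h : Admissible d p) (i : Fin 6) :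
    mChi d p * chiVal d p i = (if i = 0 then order d else 0) - d i - mPhi d p * p i := by
  unfold chiVal
  split_ifs with hi
  · subst hi
    rw [h.d_zero, h.p_zero]
    unfold mChi
    ring
  · rw [mul_div_cancel₀ _ h.mChi_pos.ne']
    ring

theorem Admissible.sum_chiVal (h : Admissible d p) : ∑ i, chiVal d p i = 0 := by
  apply mul_left_cancel₀ h.mChi_pos.ne'
  rw [Finset.mul_sum, mul_zero]
  simp only [h.mChi_mul_chiVal, Finset.sum_sub_distrib, ← Finset.mul_sum, h.sum_d, h.sum_p_eq_zero]
  simp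

theorem Admissible.sum_chiVal_mul_p (h : Admissible d p) :
    ∑ i, chiVal d p i * p i / d i = 0 := by
  apply mul_left_cancel₀ h.mChi_pos.ne'
  rw [Finset.mul_sum, mul_zero]
  have : ∀ i, mChi d p * (chiVal d p i * p i / d i) =
      (if i = 0 then order d else 0) - p i - mPhi d p * (p i ^ 2 / d i) := by
    intro i
    have := (h.d_pos i).ne'
    rw [← mul_div_assoc, ← mul_assoc, h.mChi_mul_chiVal]
    split_ifs with hi
    · subst hi
      rw [h.p_zero, h.d_zero]
      ring
    · field_simp
      ring
  simp only [this, Finset.sum_sub_distrib, ← Finset.mul_sum, h.mPhi_mul_sum, h.sum_p_eq_zero]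
  simp

theorem Admissible.sum_chiVal_sq (h : Admissible d p) :
    ∑ i, chiVal d p i * chiVal d p i / d i = 2 * order d / mChi d p := by
  rw [eq_div_iff h.mChi_pos.ne', mul_comm, Finset.mul_sum]
  have : ∀ i, mChi d p * (chiVal d p i * chiVal d p i / d i) =
      (if i = 0 then 2 * order d else 0) - chiVal d p i
        - mPhi d p * (chiVal d p i * p i / d i) := by
    intro i
    have := (h.d_pos i).ne'
    rw [← mul_div_assoc, ← mul_assoc, h.mChi_mul_chiVal]
    split_ifs with hi
    · subst hi
      have : chiVal d p 0 = 2 := if_pos rfl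
      rw [h.p_zero, h.d_zero, this]
      ring
    · field_simp
      ring
  simp only [this, Finset.sum_sub_distrib, ← Finset.mul_sum, h.sum_chiVal, h.sum_chiVal_mul_p]
  simp

theorem Admissible.exists_coordinates (h : Admissible d p) : ∃ v w z : Fin 6 → ℝ,
    (∀ i j, d i * d j + mPhi d p * (p i * p j) + mChi d p * (chiVal d p i * chiVal d p j / 2
      + 2 * (v i * v j + w i * w j + z i * z j)) = if i = j then order d * d i else 0) ∧
    v 4 = v 5 ∧ w 4 = w 5 ∧ (∀ i, i ≠ 4 → i ≠ 5 → z i = 0) ∧ z 5 = -z 4 ∧ v 0 = 0 ∧ w 0 = 0 := by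
  have hn := h.order_pos
  have hφ := h.mPhi_pos
  have hχ := h.mChi_pos
  have hd4 := h.d_pos 4
  obtain ⟨q, hq⟩ : ∃ q : ℝ, q = √(order d * d 4 / (4 * mChi d p)) := ⟨_, rfl⟩
  have hq2 : q * q = order d * d 4 / (4 * mChi d p) := by
    rw [hq]; exact Real.mul_self_sqrt (by positivity)
  have hq0 : q ≠ 0 := by
    rw [hq]; exact (Real.sqrt_pos.2 (by positivity)).ne'
  let c : ℝ := order d / (2 * mChi d p)
  have hc : 0 < c := by positivity
  let N : Fin 6 → ℝ := ![order d, order d / mPhi d p, 2 * order d / mChi d p, c, c, c]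
  have hN : ∀ k, 0 < N k := by
    intro k
    fin_cases k
    · exact hn
    · exact div_pos hn hφ
    · exact div_pos (by positivity) hχ
    all_goals exact hc
  let y : Fin 6 → Fin 6 → ℝ := ![d, p, chiVal d p, 0, 0, ![0, 0, 0, 0, q, -q]]
  have hdd : ∀ x : Fin 6 → ℝ, ∑ i, d i * x i / d i = ∑ i, x i := fun x =>
    Finset.sum_congr rfl fun i _ => mul_div_cancel_left₀ _ (h.d_pos i).ne'
  have hd5 : ∀ x : Fin 6 → ℝ, ∑ i, x i * (![0, 0, 0, 0, q, -q] : Fin 6 → ℝ) i / d i =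
      q * (x 4 - x 5) / d 4 := fun x => by
    simp only [Fin.sum_univ_six, h.d_five, Matrix.cons_val]
    ring
  have hχ5 : chiVal d p 5 = chiVal d p 4 := by
    simp [chiVal, h.d_five, h.p_five]
  have e01 : ∑ i, d i * p i / d i = 0 := by rw [hdd, h.sum_p_eq_zero]
  have e02 : ∑ i, d i * chiVal d p i / d i = 0 := by rw [hdd, h.sum_chiVal]
  have e05 : ∑ i, d i * (![0, 0, 0, 0, q, -q] : Fin 6 → ℝ) i / d i = 0 := by
    rw [hd5, h.d_five]; simp
  have e15 : ∑ i, p i * (![0, 0, 0, 0, q, -q] : Fin 6 → ℝ) i / d i = 0 := by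
    rw [hd5, h.p_five]; simp
  have e25 : ∑ i, chiVal d p i * (![0, 0, 0, 0, q, -q] : Fin 6 → ℝ) i / d i = 0 := by
    rw [hd5, hχ5]; simp
  have e55 : ∑ i, (![0, 0, 0, 0, q, -q] : Fin 6 → ℝ) i *
      (![0, 0, 0, 0, q, -q] : Fin 6 → ℝ) i / d i = c := by
    rw [hd5]
    simp only [Matrix.cons_val, c]
    rw [sub_neg_eq_add, mul_add, hq2]
    field_simp
    ring
  have e11 : ∑ i, p i * p i / d i = order d / mPhi d p := by
    rw [eq_div_iff hφ.ne', mul_comm, ← h.mPhi_mul_sum]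
    simp only [pow_two]
  have e21 := h.sum_chiVal_mul_p
  have hcomm : ∀ x x' : Fin 6 → ℝ, ∑ i, x i * x' i / d i = ∑ i, x' i * x i / d i := fun x x' =>
    Finset.sum_congr rfl fun i _ => by rw [mul_comm]
  have e00 : ∑ i, d i * d i / d i = order d := by rw [hdd, h.sum_d]
  have hy : ∀ k ∈ ({0, 1, 2, 5} : Set (Fin 6)), ∀ l ∈ ({0, 1, 2, 5} : Set (Fin 6)),
      ∑ i, y k i * y l i / d i = if k = l then N k else 0 := by
    have e10 := (hcomm _ _).trans e01
    have e20 := (hcomm _ _).trans e02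
    have e50 := (hcomm _ _).trans e05
    have e12 := (hcomm _ _).trans e21
    have e51 := (hcomm _ _).trans e15
    have e52 := (hcomm _ _).trans e25
    rintro k (rfl | rfl | rfl | rfl) l (rfl | rfl | rfl | rfl)
    · exact e00
    · exact e01
    · exact e02
    · exact e05
    · exact e10
    · exact e11
    · exact e12
    · exact e15
    · exact e20
    · exact e21
    · exact h.sum_chiVal_sq
    · exact e25
    · exact e50
    · exact e51
    · exact e52
    · exact e55
  obtain ⟨Y, hYy, hrow, hcol⟩ := exists_weighted_orthogonal_extension h.d_pos hN y _ hy
  have hY0 : Y 0 = d := hYy 0 (by simp)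
  have hY1 : Y 1 = p := hYy 1 (by simp)
  have hY2 : Y 2 = chiVal d p := hYy 2 (by simp)
  have hY5 : Y 5 = ![0, 0, 0, 0, q, -q] := hYy 5 (by simp)
  have hform : ∀ i j, d i * d j + mPhi d p * (p i * p j) + mChi d p *
      (chiVal d p i * chiVal d p j / 2 + 2 * (Y 3 i * Y 3 j + Y 4 i * Y 4 j + Y 5 i * Y 5 j))
      = if i = j then order d * d i else 0 := by
    intro i j
    have := hcol i j
    simp only [Fin.sum_univ_six, hY0, hY1, hY2, N, c, Matrix.cons_val] at this
    rw [← mul_ite_zero, ← this]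
    field_simp
    ring
  have heq : ∀ k, k ≠ 5 → Y k 4 = Y k 5 := by
    intro k hk
    have := hrow k 5
    rw [if_neg hk, hY5, hd5, div_eq_zero_iff, mul_eq_zero, sub_eq_zero] at this
    exact (this.resolve_right hd4.ne').resolve_left hq0
  have h00 := hform 0 0
  have hχ0 : chiVal d p 0 = 2 := if_pos rfl
  have hN0 : order d = 1 + mPhi d p + 2 * mChi d p := by unfold mChi; ring
  rw [if_pos rfl, h.d_zero, h.p_zero, hχ0] at h00
  have hsq : Y 3 0 * Y 3 0 + Y 4 0 * Y 4 0 + Y 5 0 * Y 5 0 = 0 := by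
    apply mul_left_cancel₀ hχ.ne'
    linear_combination h00 / 2 + hN0 / 2
  refine ⟨Y 3, Y 4, Y 5, hform, heq 3 (by decide), heq 4 (by decide), fun i h4 h5 => ?_, ?_, ?_, ?_⟩
  · rw [hY5]
    fin_cases i <;> first | rfl | exact absurd rfl h4 | exact absurd rfl h5
  · rw [hY5]; rfl
  · nlinarith [mul_self_nonneg (Y 3 0), mul_self_nonneg (Y 4 0), mul_self_nonneg (Y 5 0)]
  · nlinarith [mul_self_nonneg (Y 3 0), mul_self_nonneg (Y 4 0), mul_self_nonneg (Y 5 0)]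

end Coordinates

section Construction

/-- Entrywise complex conjugation on `ℂ ⊕ ℂ ⊕ M₂(ℂ)`. -/
noncomputable def Model.conjHom : Model →+* Model :=
  RingHom.prodMap (starRingEnd ℂ) (RingHom.prodMap (starRingEnd ℂ) (starRingEnd ℂ).mapMatrix)

/-- The trace functional on `ℂ ⊕ ℂ ⊕ M₂(ℂ)` with the given weights. -/
noncomputable def Model.weightedTrace (n μ ν : ℝ) : Model →ₗ[ℂ] ℂ :=
  (n : ℂ)⁻¹ • (modelChar AlgEquiv.refl 0 + (μ : ℂ) • modelChar AlgEquiv.refl 1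
    + (ν : ℂ) • modelChar AlgEquiv.refl 2)

theorem Model.weightedTrace_apply (n μ ν : ℝ) (x : Model) :
    Model.weightedTrace n μ ν x = (n : ℂ)⁻¹ * (x.1 + μ * x.2.1 + ν * x.2.2.trace) := rfl

theorem Model.weightedTrace_conjHom (n μ ν : ℝ) (x : Model) :
    Model.weightedTrace n μ ν (Model.conjHom x) = conj (Model.weightedTrace n μ ν x) := by
  simp [Model.weightedTrace_apply, Model.conjHom, Matrix.trace_fin_two]

/-- The element of `ℂ ⊕ ℂ ⊕ M₂(ℂ)` with real coordinates: the two one-dimensional components, the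
trace of the matrix component, and the coordinates of its traceless part. -/
noncomputable def Model.ofReal (a b c v w z : ℝ) : Model :=
  ((a : ℂ), (b : ℂ), !![((c / 2 + v : ℝ) : ℂ), ((w + z : ℝ) : ℂ);
    ((w - z : ℝ) : ℂ), ((c / 2 - v : ℝ) : ℂ)])

theorem Model.conjHom_ofReal (a b c v w z : ℝ) :
    Model.conjHom (Model.ofReal a b c v w z) = Model.ofReal a b c v w z := by
  refine Prod.ext (by simp [Model.conjHom, Model.ofReal])
    (Prod.ext (by simp [Model.conjHom, Model.ofReal]) ?_)
  ext i j
  fin_cases i <;> fin_cases j <;> simp [Model.conjHom, Model.ofReal, map_ofNat]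

theorem Model.star_ofReal (a b c v w z : ℝ) :
    star (Model.ofReal a b c v w z) = Model.ofReal a b c v w (-z) := by
  refine Prod.ext (by simp [Model.ofReal]) (Prod.ext (by simp [Model.ofReal]) ?_)
  ext i j
  fin_cases i <;> fin_cases j <;> simp [Model.ofReal, sub_eq_add_neg]

theorem Model.weightedTrace_mul_star (n μ ν a b c v w z a' b' c' v' w' z' : ℝ) :
    Model.weightedTrace n μ ν (Model.ofReal a b c v w z * star (Model.ofReal a' b' c' v' w' z')) =
      ((n⁻¹ * (a * a' + μ * (b * b') +
        ν * (c * c' / 2 + 2 * (v * v' + w * w' + z * z'))) : ℝ) : ℂ) := by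
  rw [Model.star_ofReal, Model.weightedTrace_apply]
  simp only [Model.ofReal, Matrix.trace_fin_two, Prod.fst_mul, Prod.snd_mul, Matrix.mul_apply,
    Fin.sum_univ_two, Matrix.of_apply, Matrix.cons_val]
  push_cast
  ring

theorem Model.exists_mul_ne_mul : ∃ x y : Model, x * y ≠ y * x := by
  refine ⟨Model.unit 0 1, Model.unit 1 0, fun h => ?_⟩
  rw [Model.unit_mul_unit, Model.unit_mul_unit] at h
  have := congrArg (fun x : Model => x.2.2 0 0) h
  simp [Model.unit] at this

theorem Admissible.exists_numberedBasis {d p : Fin 6 → ℝ} (h : Admissible d p) :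
    ∃ b : Module.Basis (Fin 6) ℂ Model, IsNumberedBasis b (AlgHom.fst ℂ ℂ _) ∧
      IsCharacterTable b (AlgHom.fst ℂ ℂ _) (table d p) (mult d p) := by
  obtain ⟨v, w, z, hform, hv, hw, hz, hz5, hv0, hw0⟩ := h.exists_coordinates
  have hn := h.order_pos
  have hnC : (order d : ℂ) ≠ 0 := Complex.ofReal_ne_zero.2 hn.ne'
  have hdC : ∀ i, (d i : ℂ) ≠ 0 := fun i => Complex.ofReal_ne_zero.2 (h.d_pos i).ne'
  let B : Fin 6 → Model := fun i => Model.ofReal (d i) (p i) (chiVal d p i) (v i) (w i) (z i)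
  let t : Model →ₗ[ℂ] ℂ := Model.weightedTrace (order d) (mPhi d p) (mChi d p)
  have ht : ∀ i j, t (B i * star (B j)) = if i = j then (d i : ℂ) else 0 := by
    intro i j
    simp only [t, B]
    rw [Model.weightedTrace_mul_star, hform]
    split_ifs
    · rw [inv_mul_cancel_left₀ hn.ne']
    · simp
  have hlin : LinearIndependent ℂ B := by
    rw [Fintype.linearIndependent_iff]
    intro g hg j
    have := congrArg (fun x => t (x * star (B j))) hg
    simp only [Finset.sum_mul, map_sum, smul_mul_assoc, map_smul, ht, zero_mul, map_zero,
      smul_eq_mul, mul_ite, mul_zero, Finset.sum_ite_eq', Finset.mem_univ, if_true] at this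
    exact (mul_eq_zero.1 this).resolve_right (hdC j)
  let b : Module.Basis (Fin 6) ℂ Model := basisOfLinearIndependentOfCardEqFinrank hlin
    (by rw [Model.finrank]; rfl)
  have hbB : ∀ i, b i = B i := fun i => by simp [b]
  have hrepr : ∀ x k, t (x * star (b k)) = b.repr x k * d k := by
    intro x k
    conv_lhs => rw [← b.sum_repr x]
    simp only [Finset.sum_mul, map_sum, smul_mul_assoc, map_smul, hbB, ht,
      smul_eq_mul, mul_ite, mul_zero, Finset.sum_ite_eq', Finset.mem_univ, if_true]
  let σ : Equiv.Perm (Fin 6) := Equiv.swap 4 5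
  have hσσ : ∀ i, σ (σ i) = i := Equiv.swap_apply_self 4 5
  have hstarB : ∀ i, star (b i) = b (σ i) := by
    have hχ5 : chiVal d p 5 = chiVal d p 4 := by simp [chiVal, h.d_five, h.p_five]
    intro i
    rw [hbB, hbB]
    simp only [B]
    rw [Model.star_ofReal]
    by_cases h4 : i = 4
    · subst h4
      rw [show σ 4 = 5 from Equiv.swap_apply_left 4 5, h.d_five, h.p_five, hχ5, hv, hw, hz5]
    by_cases h5 : i = 5
    · subst h5
      rw [show σ 5 = 4 from Equiv.swap_apply_right 4 5, h.d_five, h.p_five, hχ5, hv, hw, hz5,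
        neg_neg]
    · rw [show σ i = i from Equiv.swap_apply_of_ne_of_ne h4 h5, hz i h4 h5, neg_zero]
  have hstar : ∀ i j, star (b i) = b j ↔ σ i = j := fun i j => by
    rw [hstarB, b.injective.eq_iff]
  have hσd : ∀ i, d (σ i) = d i := by
    intro i
    by_cases h4 : i = 4
    · subst h4; rw [show σ 4 = 5 from Equiv.swap_apply_left 4 5, h.d_five]
    by_cases h5 : i = 5
    · subst h5; rw [show σ 5 = 4 from Equiv.swap_apply_right 4 5, h.d_five]
    · rw [show σ i = i from Equiv.swap_apply_of_ne_of_ne h4 h5]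
  have hb0 : b 0 = 1 := by
    rw [hbB]
    simp only [B]
    have hχ0 : chiVal d p 0 = 2 := if_pos rfl
    rw [h.d_zero, h.p_zero, hχ0, hv0, hw0, hz 0 (by decide) (by decide)]
    refine Prod.ext (by simp [Model.ofReal]) (Prod.ext (by simp [Model.ofReal]) ?_)
    ext i j
    fin_cases i <;> fin_cases j <;> simp [Model.ofReal]
  have hcoord : ∀ x, b.coord 0 x = t x := fun x => by
    have := hrepr x 0
    rw [hb0, star_one, mul_one, h.d_zero, Complex.ofReal_one, mul_one] at this
    exact this.symm
  have hsc0 : ∀ i j, structConst b i j 0 = if σ i = j then (d i : ℂ) else 0 := by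
    intro i j
    have e : structConst b i j 0 = b.coord 0 (b i * b j) := rfl
    rw [e, hcoord, ← hσσ j, ← hstarB, hbB, hbB, ht, hσσ]
    congr 1
    rw [eq_iff_iff]
    constructor
    · rintro rfl; exact hσσ j
    · rintro rfl; exact (hσσ i).symm
  have hreal : ∀ i j k, (structConst b i j k).im = 0 := by
    intro i j k
    have e : structConst b i j k * d k = t (b i * b j * star (b k)) := (hrepr _ _).symm
    have hconj : ∀ i, Model.conjHom (b i) = b i := fun i => by
      rw [hbB]; exact Model.conjHom_ofReal _ _ _ _ _ _
    have hr : conj (t (b i * b j * star (b k))) = t (b i * b j * star (b k)) := by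
      simp only [t]
      rw [← Model.weightedTrace_conjHom, map_mul Model.conjHom, map_mul Model.conjHom, hstarB, hconj, hconj, hconj]
    rw [← e, map_mul, Complex.conj_ofReal] at hr
    exact Complex.conj_eq_iff_im.1 (mul_right_cancel₀ (hdC k) hr)
  have hδ : ∀ i, AlgHom.fst ℂ ℂ (ℂ × Matrix (Fin 2) (Fin 2) ℂ) (b i) = d i := fun i => by
    rw [hbB]; rfl
  have hRBA : IsRBABasis b := by
    refine ⟨hb0, hreal, fun i => ⟨_, hstarB i⟩, fun i j => ?_, fun i j hij => ?_⟩
    · rw [hstar, hsc0, Ne, ite_eq_right_iff]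
      simp [hdC i]
    · rw [hstar] at hij
      rw [hsc0, hsc0, if_pos hij, if_pos (by rw [← hij, hσσ]), ← hij, hσd, Complex.ofReal_re]
      exact ⟨rfl, h.d_pos i⟩
  have hstd : IsStandardRBABasis b (AlgHom.fst ℂ ℂ _) := by
    refine ⟨hRBA, ⟨fun a => rfl, fun i => ?_⟩, fun i j hij => ?_⟩
    · rw [hδ, Complex.ofReal_im, Complex.ofReal_re]
      exact ⟨rfl, h.d_pos i⟩
    · rw [hstar] at hij
      rw [hδ, hsc0, if_pos hij]
  refine ⟨b, ⟨hstd, (hstar _ _).2 (by decide), (hstar _ _).2 (by decide), (hstar _ _).2 (by decide),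
    (hstar _ _).2 (by decide)⟩, ?_⟩
  refine (isCharacterTable_iff (f := AlgEquiv.refl) (fun a => rfl) (μ := mult d p) ?_ _ _).2
    ⟨fun k i => ?_, rfl⟩
  · refine LinearMap.ext fun x => ?_
    simp only [standardTrace, hδ, LinearMap.smul_apply, hcoord, Fin.sum_univ_three,
      LinearMap.add_apply, smul_eq_mul, t, Model.weightedTrace]
    rw [← Complex.ofReal_sum, h.sum_d, mul_inv_cancel_left₀ hnC]
    simp [mult]
  · rw [hbB]
    fin_cases k
    · rfl
    · rfl
    · simp only [modelChar_two, B, Model.ofReal, table, Matrix.trace_fin_two, AlgEquiv.coe_refl,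
        id_eq, Matrix.of_apply, Fin.reduceFinMk, Matrix.cons_val]
      push_cast
      ring

end Construction

end RBA

theorem corollary3p4 :
    -- every noncommutative RBA of rank 6 with positive degree map can be standardized and numbered
    (∀ (A : Type u) [Ring A] [Algebra ℂ A] [StarRing A] [StarModule ℂ A]
        (b : Module.Basis (Fin 6) ℂ A) (δ : A →ₐ[ℂ] ℂ),
        (∃ x y : A, x * y ≠ y * x) → RBA.IsRBABasis b → RBA.IsPositiveDegreeMap b δ →
        ∃ c : Module.Basis (Fin 6) ℂ A, RBA.IsRescaling b c ∧ RBA.IsNumberedBasis c δ) ∧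
    -- it then has exactly one character table, and this table has the stated form
    (∀ (A : Type u) [Ring A] [Algebra ℂ A] [StarRing A] [StarModule ℂ A]
        (b : Module.Basis (Fin 6) ℂ A) (δ : A →ₐ[ℂ] ℂ),
        (∃ x y : A, x * y ≠ y * x) → RBA.IsNumberedBasis b δ →
        (∀ (s : ℕ) [NeZero s] (T : Matrix (Fin s) (Fin 6) ℂ) (m : Fin s → ℂ),
          RBA.IsCharacterTable b δ T m → s = 3) ∧
        ∃ d p : Fin 6 → ℝ, RBA.Admissible d p ∧
          ∀ (T : Matrix (Fin 3) (Fin 6) ℂ) (m : Fin 3 → ℂ),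
            RBA.IsCharacterTable b δ T m ↔ T = RBA.table d p ∧ m = RBA.mult d p) ∧
    -- every table of the stated form occurs
    (∀ d p : Fin 6 → ℝ, RBA.Admissible d p →
        0 < RBA.mPhi d p ∧ 0 < RBA.mChi d p ∧
        ∃ (A : Type) (_ : Ring A) (_ : Algebra ℂ A) (_ : StarRing A) (_ : StarModule ℂ A)
          (b : Module.Basis (Fin 6) ℂ A) (δ : A →ₐ[ℂ] ℂ),
          (∃ x y : A, x * y ≠ y * x) ∧ RBA.IsNumberedBasis b δ ∧
          RBA.IsCharacterTable b δ (RBA.table d p) (RBA.mult d p)) ∧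
    -- the table determines the standard basis up to exact isomorphism
    (∀ (A : Type u) [Ring A] [Algebra ℂ A] [StarRing A] [StarModule ℂ A]
        (C : Type v) [Ring C] [Algebra ℂ C] [StarRing C] [StarModule ℂ C]
        (b : Module.Basis (Fin 6) ℂ A) (δ : A →ₐ[ℂ] ℂ)
        (c : Module.Basis (Fin 6) ℂ C) (ε : C →ₐ[ℂ] ℂ)
        (T : Matrix (Fin 3) (Fin 6) ℂ) (m : Fin 3 → ℂ),
        (∃ x y : A, x * y ≠ y * x) → (∃ x y : C, x * y ≠ y * x) →
        RBA.IsNumberedBasis b δ → RBA.IsNumberedBasis c ε →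
        RBA.IsCharacterTable b δ T m → RBA.IsCharacterTable c ε T m →
        RBA.ExactlyIsomorphic b c) := by
  refine ⟨fun A _ _ _ _ b δ hnc hb hδ => hb.exists_numbering hδ hnc,
    fun A _ _ _ _ b δ hnc hb => ⟨fun s _ T m hT => ?_, hb.exists_table hnc⟩,
    fun d p h => ⟨h.mPhi_pos, h.mChi_pos, ?_⟩,
    fun A _ _ _ _ C _ _ _ _ b δ c ε T m hA hC hb hc hTb hTc =>
      RBA.exactlyIsomorphic_of_isCharacterTable hA hC hb hc hTb hTc⟩
  · obtain ⟨f, -⟩ := hb.isStandardRBABasis.isRBABasis.exists_algEquiv_model δ hnc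
    exact RBA.card_eq_three_of_isCharacterTable f hT
  · obtain ⟨b, hb, hT⟩ := h.exists_numberedBasis
    exact ⟨RBA.Model, inferInstance, inferInstance, inferInstance, inferInstance, b, _,
      RBA.Model.exists_mul_ne_mul, hb, hT⟩
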